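/- Let $(M^4,g)$ be an oriented smooth four-dimensional Riemannian manifold, let $W$ be its Weyl tensor, and let $W^{+}$ and $W^{-}$ be the self-dual and anti-self-dual parts of $W$, i.e. the $\Lambda^{\pm}\to\Lambda^{\pm}$ blocks of $W$ acting on two-forms, where $\Lambda^{\pm}$ is the $\pm1$ eigenspace of the Hodge star on $\Lambda^2$. Regard $W^\pm$ as a $(0,4)$-tensor, let $\nabla$ be the Levi-Civita connection, let $(\delta W^{\pm})_{ijk}=g^{ts}\,\nabla_s W^{\pm}_{tijk}$ be the divergence, and let $|T|^2=g^{i_1j_1}\cdots g^{i_nj_n}T_{i_1\dots i_n}T_{j_1\dots j_n}$ be the squared norm of a covariant tensor $T$ of rank $n$. Then, for each choice of sign $\pm$, at every point where $|W^{\pm}|\neq 0$, $$|\nabla W^{\pm}|^{2}\;\geq\; k\,\big|\nabla|W^{\pm}|\big|^{2}-\frac{8(k-1)}{5-3k}\,|\delta W^{\pm}|^{2}\qquad\text{for every } k\in\left[0,\tfrac53\right).$$ Moreover, at every point where $|W^{\pm}|\neq0$ and $\delta W^{\pm}=0$ (in particular, at every point where $|W^\pm|\neq 0$ if $\delta W^{\pm}\equiv0$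 on $M$), $$|\nabla W^{\pm}|^{2}\;\geq\;\tfrac53\,\big|\nabla|W^{\pm}|\big|^{2}.$$ -/

import Mathlib

open scoped Manifold ContDiff

noncomputable section

namespace KatoWeyl

/-- The model space `ℝ⁴`. -/
abbrev E4 : Type := EuclideanSpace ℝ (Fin 4)

/-! ### Tensor calculus in a coordinate domain of `ℝ⁴`

A metric on a coordinate domain is given by its matrix `G y = (g_ij(y))`; a covariant tensor
of rank `n` at a point is given by its components, indexed by the multi-indices
`Fin n → Fin 4`; a tensor field is a function of the coordinate point `y : E4`. -/

/-- Components of a covariant tensor of rank `n` at a point. -/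
abbrev Tensor (n : ℕ) : Type := (Fin n → Fin 4) → ℝ

/-- The partial derivative `∂f / ∂y^t`. -/
def pderiv (t : Fin 4) (f : E4 → ℝ) (y : E4) : ℝ :=
  fderiv ℝ f y (EuclideanSpace.single t 1)

/-- The Christoffel symbols `Γ^m_{ij}` of the Levi-Civita connection of the metric `G`. -/
def christoffel (G : E4 → Matrix (Fin 4) (Fin 4) ℝ) (y : E4) (m i j : Fin 4) : ℝ :=
  1 / 2 * ∑ l, (G y)⁻¹ m l *
    (pderiv i (fun z => G z j l) y + pderiv j (fun z => G z i l) y - pderiv l (fun z => G z i j) y)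

/-- The components `R^l_{ijk}` of the `(1,3)` curvature tensor,
`R^l_{ijk} ∂_l = R(∂_j, ∂_k) ∂_i = ∇_j ∇_k ∂_i - ∇_k ∇_j ∂_i`. -/
def curvature (G : E4 → Matrix (Fin 4) (Fin 4) ℝ) (y : E4) (l i j k : Fin 4) : ℝ :=
  pderiv j (fun z => christoffel G z l k i) y - pderiv k (fun z => christoffel G z l j i) y
    + ∑ m, (christoffel G y l j m * christoffel G y m k i
        - christoffel G y l k m * christoffel G y m j i)

/-- The `(0,4)` curvature tensor `R_{ijkl} = g_{im} R^m_{jkl}`. -/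
def riemann (G : E4 → Matrix (Fin 4) (Fin 4) ℝ) (y : E4) (i j k l : Fin 4) : ℝ :=
  ∑ m, G y i m * curvature G y m j k l

/-- The Ricci tensor `R_{ik} = g^{jl} R_{ijkl}`. -/
def ricci (G : E4 → Matrix (Fin 4) (Fin 4) ℝ) (y : E4) (i k : Fin 4) : ℝ :=
  ∑ j, ∑ l, (G y)⁻¹ j l * riemann G y i j k l

/-- The scalar curvature `R = g^{ik} R_{ik}`. -/
def scalarCurvature (G : E4 → Matrix (Fin 4) (Fin 4) ℝ) (y : E4) : ℝ :=
  ∑ i, ∑ k, (G y)⁻¹ i k * ricci G y i k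

/-- The Weyl tensor `W_{ijkl}` in dimension four. -/
def weyl (G : E4 → Matrix (Fin 4) (Fin 4) ℝ) (y : E4) (i j k l : Fin 4) : ℝ :=
  riemann G y i j k l
    - 1 / 2 * (ricci G y i k * G y j l - ricci G y i l * G y j k
        + ricci G y j l * G y i k - ricci G y j k * G y i l)
    + scalarCurvature G y / 6 * (G y i k * G y j l - G y i l * G y j k)

/-- The components of the Riemannian volume form in positively oriented coordinates: `√(det g)`
times the Levi-Civita symbol. -/
def volumeForm (G : E4 → Matrix (Fin 4) (Fin 4) ℝ) (y : E4) (i j k l : Fin 4) : ℝ :=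
  √(G y).det * ((1 : Matrix (Fin 4) (Fin 4) ℝ).submatrix ![i, j, k, l] id).det

/-- The Hodge star on two-forms at `y`:
`(⋆η)_{ij} = (1/2) vol_{ijab} g^{ac} g^{bd} η_{cd}`. -/
def hodgeStar (G : E4 → Matrix (Fin 4) (Fin 4) ℝ) (y : E4) (η : Fin 4 → Fin 4 → ℝ)
    (i j : Fin 4) : ℝ :=
  1 / 2 * ∑ a, ∑ b, ∑ c, ∑ d,
    volumeForm G y i j a b * (G y)⁻¹ a c * (G y)⁻¹ b d * η c d

/-- The orthogonal projection `(1 ± ⋆)/2` of `Λ²` onto the eigenspace `Λ^±` of the Hodge star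
for the eigenvalue `±1`; the sign is `s`. -/
def halfProj (s : ℤˣ) (G : E4 → Matrix (Fin 4) (Fin 4) ℝ) (y : E4) (η : Fin 4 → Fin 4 → ℝ)
    (i j : Fin 4) : ℝ :=
  1 / 2 * (η i j + ((s : ℤ) : ℝ) * hodgeStar G y η i j)

/-- The (anti-)self-dual Weyl tensor `W^±`: the `Λ^± → Λ^±` block of the Weyl tensor seen as an
endomorphism of `Λ²`. As the projection onto `Λ^±` is self-adjoint, the `(0,4)` tensor of
this block is `W` with both of its index pairs projected to `Λ^±`. -/
def halfWeyl (s : ℤˣ) (G : E4 → Matrix (Fin 4) (Fin 4) ℝ) (y : E4) : Tensor 4 := fun I =>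
  halfProj s G y
    (fun a b => halfProj s G y (fun c d => weyl G y a b c d) (I 2) (I 3)) (I 0) (I 1)

/-- The covariant derivative `∇T` of a covariant tensor field; the last index is the
direction of differentiation:
`T_{i₁…iₙ,t} = ∂_t T_{i₁…iₙ} - ∑_a Γ^m_{t i_a} T_{i₁…m…iₙ}`. -/
def nabla {n : ℕ} (G : E4 → Matrix (Fin 4) (Fin 4) ℝ) (T : E4 → Tensor n) (y : E4) :
    Tensor (n + 1) := fun I =>
  pderiv (I (Fin.last n)) (fun z => T z (Fin.init I)) y
    - ∑ a : Fin n, ∑ m : Fin 4,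
        christoffel G y m (I (Fin.last n)) (Fin.init I a) * T y (Function.update (Fin.init I) a m)

/-- The divergence `(δT)_{ijk} = g^{ts} T_{tijk,s}` of a rank-four covariant tensor field. -/
def divergence (G : E4 → Matrix (Fin 4) (Fin 4) ℝ) (T : E4 → Tensor 4) (y : E4) : Tensor 3 :=
  fun I => ∑ t, ∑ s, (G y)⁻¹ t s * nabla G T y ![t, I 0, I 1, I 2, s]

/-- The squared norm `|T|² = g^{i₁j₁} ⋯ g^{iₙjₙ} T_{i₁…iₙ} T_{j₁…jₙ}` at `y`. -/
def normSq {n : ℕ} (G : E4 → Matrix (Fin 4) (Fin 4) ℝ) (y : E4) (T : Tensor n) : ℝ :=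
  ∑ I : Fin n → Fin 4, ∑ J : Fin n → Fin 4, (∏ a, (G y)⁻¹ (I a) (J a)) * T I * T J

/-- The function `|W^±|`. -/
def normHalfWeyl (s : ℤˣ) (G : E4 → Matrix (Fin 4) (Fin 4) ℝ) (y : E4) : ℝ :=
  √(normSq G y (halfWeyl s G y))

/-- `|∇W^±|²`. -/
def gradHalfWeylSq (s : ℤˣ) (G : E4 → Matrix (Fin 4) (Fin 4) ℝ) (y : E4) : ℝ :=
  normSq G y (nabla G (halfWeyl s G) y)

/-- `|∇|W^±||²`, where `∇|W^±|` is the differential of the function `|W^±|`. -/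
def gradNormHalfWeylSq (s : ℤˣ) (G : E4 → Matrix (Fin 4) (Fin 4) ℝ) (y : E4) : ℝ :=
  normSq (n := 1) G y (fun I => pderiv (I 0) (normHalfWeyl s G) y)

/-- `|δW^±|²`. -/
def divHalfWeylSq (s : ℤˣ) (G : E4 → Matrix (Fin 4) (Fin 4) ℝ) (y : E4) : ℝ :=
  normSq G y (divergence G (halfWeyl s G) y)

/-! ### Oriented Riemannian four-manifolds -/

/-- An orientation of the smooth four-manifold `M`, given by an oriented atlas: smooth charts
covering `M` whose transition maps have everywhere positive Jacobian determinant. -/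
structure OrientedAtlas (M : Type*) [TopologicalSpace M] [ChartedSpace E4 M]
    [IsManifold (𝓡 4) ∞ M] where
  charts : Set (OpenPartialHomeomorph M E4)
  smooth : charts ⊆ IsManifold.maximalAtlas (𝓡 4) ∞ M
  covers : ∀ x : M, ∃ φ ∈ charts, x ∈ φ.source
  oriented : ∀ φ ∈ charts, ∀ ψ ∈ charts, ∀ y ∈ (φ.symm.trans ψ).source,
    0 < (fderiv ℝ (φ.symm.trans ψ) y).det

/-- A smooth Riemannian metric on the smooth four-manifold `M`. -/
abbrev Metric (M : Type*) [TopologicalSpace M] [ChartedSpace E4 M] [IsManifold (𝓡 4) ∞ M] :=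
  Bundle.ContMDiffRiemannianMetric (𝓡 4) ∞ E4 (fun x : M => TangentSpace (𝓡 4) x)

/-- The coordinate vector field `∂/∂y^i` of the chart `φ` at the point with coordinates `y`. -/
def coordVector {M : Type*} [TopologicalSpace M] [ChartedSpace E4 M]
    (φ : OpenPartialHomeomorph M E4) (y : E4) (i : Fin 4) : TangentSpace (𝓡 4) (φ.symm y) :=
  mfderiv 𝓘(ℝ, E4) (𝓡 4) φ.symm y (EuclideanSpace.single i (1 : ℝ) : E4)

/-- The components `g_ij = g(∂_i, ∂_j)` of the metric in the chart `φ`, as functions of the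
coordinates. -/
def metricMatrix {M : Type*} [TopologicalSpace M] [ChartedSpace E4 M] [IsManifold (𝓡 4) ∞ M]
    (g : Metric M) (φ : OpenPartialHomeomorph M E4) (y : E4) : Matrix (Fin 4) (Fin 4) ℝ :=
  Matrix.of fun i j => g.inner (φ.symm y) (coordVector φ y i) (coordVector φ y j)

end KatoWeyl

end

open scoped Manifold ContDiff

noncomputable section

namespace KatoWeyl

/-! Work at one point, in an orthonormal frame. All that is needed of W = W^± is that W and each ∇_s
W have the algebraic symmetries of a Weyl tensor. The driving estimate is 8 |div X|² ≤ 5 |X|² for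
every X in ℝ⁴ ⊗ {Weyl tensors} (`eight_mul_sum_divergence_sq_le`). On the self-dual (or
anti-self-dual) half, which has dimension 4 · 5 = 20, the divergence is a constant times an isometry
on an 8-dimensional summand and vanishes on the complementary 12-dimensional one, so the constant is
sharp.

Apply the estimate to X − c v ⊗ W, where X = ∇W, v = |W| ∇|W| and c is any real number. Since v_s =
⟨∇_s W, W⟩, one has ⟨X, v ⊗ W⟩ = |v|², and in dimension four |div(v ⊗ W)|² = |v|² |W|² / 4
(`IsWeyl.sum_contract_sq`). The estimate thus becomes a quadratic polynomial in c that is nowhere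
negative, and its discriminant gives (5|v|² − 8r)² ≤ 3 |v|² |W|² (5|∇W|² − 8|δW|²), with r = ⟨δW,
div(v ⊗ W)⟩. If δW = 0, then r = 0 and this is the constant 5/3. For k < 5/3, Cauchy–Schwarz bounds
r, and a weighted Young inequality with weights 5 − 3k and 3k recovers |v|² (`kato_core`).

The rest supplies the inputs from the coordinate formulas: the Weyl symmetries of W^±
(`IsMetricOn.isWeyl_weyl`, `isWeyl_halfWeyl`), those of ∇W^± (`IsMetricOn.isWeyl_nabla`), and v_s =
⟨∇_s W, W⟩ from metric compatibility (`IsMetricOn.pderiv_normSq`). -/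

/-! ### Electric and magnetic parts of Weyl-type tensors in an orthonormal frame. -/

/-- The two-form on `ℝ⁴` with electric part `x` and magnetic part `u`. -/
def twoForm {V : Type*} [AddCommGroup V] (x u : Fin 3 → V) : Fin 4 → Fin 4 → V :=
  ![![0, x 0, x 1, x 2], ![-x 0, 0, u 2, -u 1], ![-x 1, -u 2, 0, u 0], ![-x 2, u 1, -u 0, 0]]

/-- The curvature-type tensor on `ℝ⁴` with electric part `A` and magnetic part `B`. -/
def weylOf (A B : Fin 3 → Fin 3 → ℝ) : Fin 4 → Fin 4 → Fin 4 → Fin 4 → ℝ :=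
  twoForm (fun a => twoForm (A a) (B a)) (fun a => twoForm (B a) (A a))

/-- The algebraic symmetries of the Weyl tensor; traces are taken with the contravariant
metric `H`. -/
structure IsWeyl (H : Matrix (Fin 4) (Fin 4) ℝ) (T : Fin 4 → Fin 4 → Fin 4 → Fin 4 → ℝ) :
    Prop where
  antisymm_left : ∀ i j k l, T i j k l = -T j i k l
  antisymm_right : ∀ i j k l, T i j k l = -T i j l k
  bianchi : ∀ i j k l, T i j k l + T i k l j + T i l j k = 0
  trace : ∀ j l, ∑ i, ∑ k, H i k * T i j k l = 0

/-- Symmetric and trace-free `3 × 3` arrays. -/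
structure SymmTraceless (A : Fin 3 → Fin 3 → ℝ) : Prop where
  symm : ∀ i j, A i j = A j i
  trace : A 2 2 = -A 0 0 - A 1 1

theorem eq_twoForm {V : Type*} [AddCommGroup V] [Module ℝ V] (η : Fin 4 → Fin 4 → V)
    (h : ∀ i j, η i j = -η j i) :
    η = twoForm ![η 0 1, η 0 2, η 0 3] ![η 2 3, η 3 1, η 1 2] := by
  have h0 : ∀ i, η i i = 0 := fun i => by
    have := h i i
    rw [eq_neg_iff_add_eq_zero, ← two_smul ℝ] at this
    simpa using this
  funext i j
  fin_cases i <;> fin_cases j <;> simp [twoForm, h0] <;> first | done | exact h _ _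

/-- The octahedron argument: combine the Bianchi identities for the four cyclic shifts of (i, j, k,
l) with the antisymmetries. -/
theorem IsWeyl.pair_symm {H : Matrix (Fin 4) (Fin 4) ℝ} {T : Fin 4 → Fin 4 → Fin 4 → Fin 4 → ℝ}
    (h : IsWeyl H T) (i j k l : Fin 4) : T i j k l = T k l i j := by
  have a := h.antisymm_left
  have b := h.antisymm_right
  have c := h.bianchi
  linarith [c i j k l, c j k l i, c k l i j, c l i j k, a i j k l, b i j k l, a j k l i,
    b j k l i, a k l i j, b k l i j, a l i j k, b l i j k, a i k l j, b i k l j, a i l j k,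
    b i l j k, a j l i k, b j l i k, a j i k l, b j i k l, a k i j l, b k i j l, a k j l i,
    b k j l i, a l j k i, b l j k i, a l k i j, b l k i j, a i k j l, a j l k i, b j k i l]

/-- A is T_{0a0b}, and B is T_{0a··} on the pairs 23, 31, 12. The 00 trace makes A trace-free, the
mixed 0a traces make B symmetric, and the Bianchi identity makes B trace-free. The remaining traces
force the purely spatial block to equal A. -/
theorem IsWeyl.exists_eq_weylOf {T : Fin 4 → Fin 4 → Fin 4 → Fin 4 → ℝ} (h : IsWeyl 1 T) :
    ∃ A B, SymmTraceless A ∧ SymmTraceless B ∧ T = weylOf A B := by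
  have a := h.antisymm_left
  have b := h.antisymm_right
  have c := h.bianchi
  have p := h.pair_symm
  have a0 : ∀ i k l, T i i k l = 0 := fun i k l => by linarith [a i i k l]
  have b0 : ∀ i k l, T k l i i = 0 := fun i k l => by linarith [b k l i i]
  have t := h.trace
  simp only [Matrix.one_apply, ite_mul, one_mul, zero_mul, Finset.sum_ite_eq, Finset.mem_univ,
    if_true, Fin.sum_univ_four] at t
  have t00 := t 0 0
  have t11 := t 1 1
  have t22 := t 2 2
  have t33 := t 3 3
  have t01 := t 0 1
  have t02 := t 0 2
  have t03 := t 0 3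
  have t12 := t 1 2
  have t13 := t 1 3
  have t23 := t 2 3
  simp only [a0, b0] at t00 t11 t22 t33 t01 t02 t03 t12 t13 t23
  refine ⟨fun i => ![T 0 i.succ 0 1, T 0 i.succ 0 2, T 0 i.succ 0 3],
    fun i => ![T 0 i.succ 2 3, T 0 i.succ 3 1, T 0 i.succ 1 2], ⟨?_, ?_⟩, ⟨?_, ?_⟩, ?_⟩
  · intro i j
    fin_cases i <;> fin_cases j <;> first | rfl | exact p _ _ _ _
  · change T 0 3 0 3 = -T 0 1 0 1 - T 0 2 0 2
    linarith [a 1 0 1 0, b 0 1 1 0, a 2 0 2 0, b 0 2 2 0, a 3 0 3 0, b 0 3 3 0]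
  · have h12 : T 0 1 3 1 = T 0 2 2 3 := by
      linarith [b 0 1 3 1, a 0 1 1 3, a 0 2 2 3, p 2 0 2 3]
    have h13 : T 0 1 1 2 = T 0 3 2 3 := by
      linarith [b 0 3 2 3, a 0 3 3 2, a 0 1 1 2, p 3 0 3 2]
    have h23 : T 0 2 1 2 = T 0 3 3 1 := by
      linarith [b 0 2 1 2, a 0 2 2 1, a 0 3 3 1, p 3 0 3 1]
    intro i j
    fin_cases i <;> fin_cases j <;>
      first
      | rfl
      | exact h12
      | exact h13
      | exact h23
      | exact h12.symm
      | exact h13.symm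
      | exact h23.symm
  · change T 0 3 1 2 = -T 0 1 2 3 - T 0 2 3 1
    linarith [c 0 1 2 3]
  · have e : ∀ i j, T i j = twoForm ![T i j 0 1, T i j 0 2, T i j 0 3]
        ![T i j 2 3, T i j 3 1, T i j 1 2] := fun i j => eq_twoForm _ fun k l => b i j k l
    have hT : T = _ := eq_twoForm T fun i j => by
      funext k l
      exact a i j k l
    have h12 : T 0 1 3 1 = T 0 2 2 3 := by
      linarith [b 0 1 3 1, a 0 1 1 3, a 0 2 2 3, p 2 0 2 3]
    have h13 : T 0 1 1 2 = T 0 3 2 3 := by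
      linarith [b 0 3 2 3, a 0 3 3 2, a 0 1 1 2, p 3 0 3 2]
    have h23 : T 0 2 1 2 = T 0 3 3 1 := by
      linarith [b 0 2 1 2, a 0 2 2 1, a 0 3 3 1, p 3 0 3 1]
    have n : ∀ i j k l, T i j k l = T j i l k := fun i j k l => by rw [a, b, neg_neg]
    have q1 : T 2 3 2 3 = T 0 1 0 1 := by
      linarith [n 1 0 1 0, n 2 0 2 0, n 3 0 3 0, n 2 1 2 1, n 3 1 3 1, n 3 2 3 2]
    have q2 : T 3 1 3 1 = T 0 2 0 2 := by
      linarith [n 1 0 1 0, n 2 0 2 0, n 3 0 3 0, n 2 1 2 1, n 3 1 3 1, n 3 2 3 2]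
    have q3 : T 1 2 1 2 = T 0 3 0 3 := by
      linarith [n 1 0 1 0, n 2 0 2 0, n 3 0 3 0, n 2 1 2 1, n 3 1 3 1, n 3 2 3 2]
    have q12 : T 2 3 3 1 = T 0 1 0 2 := by
      linarith [p 2 3 3 1, b 3 1 2 3]
    have q13 : T 2 3 1 2 = T 0 1 0 3 := by linarith [p 2 3 1 2, a 1 2 2 3]
    have q23 : T 3 1 1 2 = T 0 2 0 3 := by linarith [b 3 1 1 2, a 3 1 1 2, p 1 2 1 3]
    rw [hT, weylOf]
    congr 1
    · funext i
      fin_cases i <;> exact e _ _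
    · funext i
      fin_cases i
      · refine (e 2 3).trans ?_
        rw [p 2 3 0 1, p 2 3 0 2, p 2 3 0 3, q1, q12, q13, ← h12, ← h13]
        rfl
      · refine (e 3 1).trans ?_
        rw [p 3 1 0 1, p 3 1 0 2, p 3 1 0 3, p 3 1 2 3, q12, q2, q23, h12, ← h23, p 0 1 0 2]
        rfl
      · refine (e 1 2).trans ?_
        rw [p 1 2 0 1, p 1 2 0 2, p 1 2 0 3, p 1 2 2 3, p 1 2 3 1, q13, q23, q3, h13, h23,
          p 0 1 0 3, p 0 2 0 3]
        rfl

theorem twoForm_antisymm {V : Type*} [AddCommGroup V] (x u : Fin 3 → V) (i j : Fin 4) :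
    twoForm x u i j = -twoForm x u j i := by
  fin_cases i <;> fin_cases j <;> simp [twoForm]

theorem isWeyl_weylOf {A B : Fin 3 → Fin 3 → ℝ} (hA : SymmTraceless A) (hB : SymmTraceless B) :
    IsWeyl 1 (weylOf A B) where
  antisymm_left i j k l := by
    rw [weylOf, twoForm_antisymm _ _ i j]
    rfl
  antisymm_right i j k l := by
    fin_cases i <;> fin_cases j <;>
      simp only [weylOf, twoForm, Matrix.cons_val, Fin.mk_one, Fin.zero_eta, Fin.reduceFinMk,
        Pi.zero_apply, Pi.neg_apply, neg_zero, neg_inj] <;>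
      exact twoForm_antisymm _ _ k l
  bianchi i j k l := by
    have a10 := hA.symm 1 0
    have a20 := hA.symm 2 0
    have a21 := hA.symm 2 1
    have b10 := hB.symm 1 0
    have b20 := hB.symm 2 0
    have b21 := hB.symm 2 1
    fin_cases i <;> fin_cases j <;> fin_cases k <;> fin_cases l <;>
      simp only [weylOf, twoForm, Matrix.cons_val, Fin.mk_one, Fin.zero_eta, Fin.reduceFinMk,
        Pi.zero_apply, Pi.neg_apply, a10, a20, a21, b10, b20, b21, hB.trace] <;> ring
  trace j l := by
    have a10 := hA.symm 1 0
    have a20 := hA.symm 2 0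
    have a21 := hA.symm 2 1
    have b10 := hB.symm 1 0
    have b20 := hB.symm 2 0
    have b21 := hB.symm 2 1
    simp only [Matrix.one_apply, ite_mul, one_mul, zero_mul, Finset.sum_ite_eq, Finset.mem_univ,
      if_true, Fin.sum_univ_four]
    fin_cases j <;> fin_cases l <;>
      simp only [weylOf, twoForm, Matrix.cons_val, Fin.mk_one, Fin.zero_eta, Fin.reduceFinMk,
        Pi.zero_apply, Pi.neg_apply, a10, a20, a21, b10, b20, b21, hA.trace] <;> ring

/-- The values lie in a general group V because a rank-four tensor is a two-form with values in
two-forms; this is then used once for each index pair. -/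
theorem sum_twoForm {V : Type*} [AddCommGroup V] (f : V → ℝ) (h0 : f 0 = 0)
    (hf : ∀ v, f (-v) = f v) (x u : Fin 3 → V) :
    ∑ i, ∑ j, f (twoForm x u i j) = 2 * ∑ a, (f (x a) + f (u a)) := by
  simp only [Fin.sum_univ_four, Fin.sum_univ_three, twoForm, Matrix.cons_val, h0, hf]
  ring

theorem sum_twoForm_sq (x u : Fin 3 → ℝ) :
    ∑ i, ∑ j, twoForm x u i j ^ 2 = 2 * ∑ a, (x a ^ 2 + u a ^ 2) :=
  sum_twoForm (fun v => v ^ 2) (by simp) (by simp) x u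

theorem sum_weylOf_sq (A B : Fin 3 → Fin 3 → ℝ) :
    ∑ i, ∑ j, ∑ k, ∑ l, weylOf A B i j k l ^ 2 = 8 * ∑ a, ∑ b, (A a b ^ 2 + B a b ^ 2) := by
  rw [weylOf, sum_twoForm (fun η : Fin 4 → Fin 4 → ℝ => ∑ k, ∑ l, η k l ^ 2) (by simp) (by simp)]
  simp only [sum_twoForm_sq]
  simp only [Fin.sum_univ_three]
  ring

theorem twoForm_sum {ι : Type*} [Fintype ι] (x u : ι → Fin 3 → ℝ) (k l : Fin 4) :
    ∑ t, twoForm (x t) (u t) k l = twoForm (fun c => ∑ t, x t c) (fun c => ∑ t, u t c) k l := by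
  fin_cases k <;> fin_cases l <;> simp [twoForm]

/-- Expands the second index pair instead of the first. The divergence contracts the first index, so
in this form the last pair only contributes a sum over components, and a two-form in the first pair
is left to contract. -/
theorem weylOf_eq_twoForm (A B : Fin 3 → Fin 3 → ℝ) (i j k l : Fin 4) :
    weylOf A B i j k l = twoForm (fun c => twoForm (fun a => A a c) (fun a => B a c) i j)
      (fun c => twoForm (fun a => B a c) (fun a => A a c) i j) k l := by
  fin_cases i <;> fin_cases j <;> fin_cases k <;> fin_cases l <;>
    simp only [weylOf, twoForm, Matrix.cons_val, Fin.mk_one, Fin.zero_eta, Fin.reduceFinMk,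
      Pi.zero_apply, Pi.neg_apply, neg_zero]

theorem sum_divergence_weylOf_sq (A B : Fin 4 → Fin 3 → Fin 3 → ℝ) :
    ∑ j, ∑ k, ∑ l, (∑ t, weylOf (A t) (B t) t j k l) ^ 2
      = 2 * ∑ j, ∑ c, ((∑ t, twoForm (fun a => A t a c) (fun a => B t a c) t j) ^ 2
        + (∑ t, twoForm (fun a => B t a c) (fun a => A t a c) t j) ^ 2) := by
  simp only [weylOf_eq_twoForm, twoForm_sum, sum_twoForm_sq, Finset.mul_sum]

theorem weylOf_smul (c : ℝ) (A B : Fin 3 → Fin 3 → ℝ) (i j k l : Fin 4) :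
    weylOf (c • A) (c • B) i j k l = c * weylOf A B i j k l := by
  fin_cases i <;> fin_cases j <;> fin_cases k <;> fin_cases l <;>
    simp only [weylOf, twoForm, Matrix.cons_val, Fin.mk_one, Fin.zero_eta, Fin.reduceFinMk,
      Pi.zero_apply, Pi.neg_apply, Pi.smul_apply, smul_eq_mul, neg_neg, mul_neg, mul_zero, neg_zero]

/-- In dimension four, `W_{iabc} W_{jabc} = |W|² δ_ij / 4`. -/
theorem IsWeyl.sum_contract_sq {W : Fin 4 → Fin 4 → Fin 4 → Fin 4 → ℝ} (h : IsWeyl 1 W)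
    (e : Fin 4 → ℝ) :
    ∑ j, ∑ k, ∑ l, (∑ i, e i * W i j k l) ^ 2
      = 1 / 4 * (∑ i, e i ^ 2) * ∑ i, ∑ j, ∑ k, ∑ l, W i j k l ^ 2 := by
  obtain ⟨A, B, hA, hB, rfl⟩ := h.exists_eq_weylOf
  -- The contraction of e with W is the divergence of the family e_t W, so the formula for the norm
  -- of a divergence applies.
  simp only [← weylOf_smul]
  rw [sum_divergence_weylOf_sq (fun t => e t • A) (fun t => e t • B), sum_weylOf_sq]
  simp only [Fin.sum_univ_four, Fin.sum_univ_three, twoForm, Matrix.cons_val, Pi.smul_apply,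
    smul_eq_mul, hA.symm 1 0, hA.symm 2 0, hA.symm 2 1, hB.symm 1 0, hB.symm 2 0, hB.symm 2 1,
    hA.trace, hB.trace]
  ring

/-! ### The sharp divergence estimate. -/

/-- The sharp bound of the divergence of a symmetric trace-free `3 × 3` array by its
derivative, for the Dirac-type operator `U ↦ (div U, ∂₀ U + curl U)`. -/
theorem two_mul_sum_divergence_sq_le {U : Fin 4 → Fin 3 → Fin 3 → ℝ}
    (h : ∀ t, SymmTraceless (U t)) :
    2 * ∑ j, ∑ c, (∑ t, twoForm (fun a => U t a c) (fun a => U t a c) t j) ^ 2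
      ≤ 5 * ∑ t, ∑ a, ∑ b, U t a b ^ 2 := by
  simp only [Fin.sum_univ_four, Fin.sum_univ_three, twoForm, Matrix.cons_val, (h _).symm 1 0,
    (h _).symm 2 0, (h _).symm 2 1, (h _).trace]
  -- The difference of the two sides is 5 times the squared norm of the component of U in the
  -- 12-dimensional kernel of the operator. Hence it has rank 12, and completing squares gives
  -- exactly twelve of them.
  refine sub_nonneg.1 (le_of_le_of_eq (b :=
    (1 / 6 : ℝ) * (6 * U 0 0 0 + 3 * U 0 1 1 - 2 * U 1 1 2 + 4 * U 2 0 2 - 2 * U 3 0 1) ^ 2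
    + 2 / 3 * (3 * U 0 0 1 - U 1 0 2 + U 2 1 2 + U 3 0 0 - U 3 1 1) ^ 2
    + 2 / 3 * (3 * U 0 0 2 + U 1 0 1 - 2 * U 2 0 0 - U 2 1 1 - U 3 1 2) ^ 2
    + 2 / 3 * (3 * U 0 1 2 + U 1 0 0 + 2 * U 1 1 1 - U 2 0 1 + U 3 0 2) ^ 2
    + 1 / 48 * (16 * U 1 0 0 + 5 * U 1 1 1 - 4 * U 2 0 1 - 14 * U 3 0 2) ^ 2
    + 1 / 12 * (8 * U 1 0 1 + 5 * U 2 0 0 - 2 * U 2 1 1 - 2 * U 3 1 2) ^ 2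
    + 1 / 12 * (8 * U 1 0 2 - 2 * U 2 1 2 + 7 * U 3 0 0 + 2 * U 3 1 1) ^ 2
    + 1 / 48 * (-9 * U 0 1 1 + 16 * U 1 1 2 + 10 * U 2 0 2 + 4 * U 3 0 1) ^ 2
    + 5 / 16 * (3 * U 1 1 1 + 4 * U 2 0 1 - 2 * U 3 0 2) ^ 2
    + 5 / 4 * (U 2 0 0 + 2 * U 2 1 1 - 2 * U 3 1 2) ^ 2
    + 5 / 4 * (2 * U 2 1 2 + U 3 0 0 + 2 * U 3 1 1) ^ 2
    + 5 / 16 * (3 * U 0 1 1 + 2 * U 2 0 2 + 4 * U 3 0 1) ^ 2) (by positivity) ?_)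
  ring

theorem SymmTraceless.smul {A : Fin 3 → Fin 3 → ℝ} (hA : SymmTraceless A) (c : ℝ) :
    SymmTraceless (fun a b => c * A a b) :=
  ⟨fun i j => by rw [hA.symm i j], by rw [hA.trace]; ring⟩

theorem SymmTraceless.add {A B : Fin 3 → Fin 3 → ℝ} (hA : SymmTraceless A)
    (hB : SymmTraceless B) : SymmTraceless (fun a b => A a b + B a b) :=
  ⟨fun i j => by rw [hA.symm i j, hB.symm i j], by rw [hA.trace, hB.trace]; ring⟩

/-- The reflection of the three spatial axes exchanges self-dual and anti-self-dual forms, so it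
transfers the self-dual estimate to the anti-self-dual half at the cost of signs that disappear on
squaring. -/
theorem sum_twoForm_parity (V : Fin 4 → Fin 3 → ℝ) (j : Fin 4) :
    ∑ t, twoForm (V t) (fun a => -V t a) t j = (![-1, 1, 1, 1] : Fin 4 → ℝ) j *
      ∑ t, twoForm (fun a => (![1, -1, -1, -1] : Fin 4 → ℝ) t * V t a)
        (fun a => (![1, -1, -1, -1] : Fin 4 → ℝ) t * V t a) t j := by
  fin_cases j <;> simp [twoForm, Fin.sum_univ_four]
  ring

/-- A + B and A − B are, up to scale, the self-dual and anti-self-dual halves. By the parallelogram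
law both |X|² and |div X|² split orthogonally along them, so the estimate for each half adds up to
the full one. -/
theorem eight_mul_sum_divergence_sq_le {X : Fin 4 → Fin 4 → Fin 4 → Fin 4 → Fin 4 → ℝ}
    (h : ∀ t, IsWeyl 1 (X t)) :
    8 * ∑ j, ∑ k, ∑ l, (∑ t, X t t j k l) ^ 2
      ≤ 5 * ∑ t, ∑ i, ∑ j, ∑ k, ∑ l, X t i j k l ^ 2 := by
  choose A B hA hB hX using fun t => (h t).exists_eq_weylOf
  simp only [hX]
  simp only [sum_weylOf_sq]
  rw [sum_divergence_weylOf_sq]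
  have hU := two_mul_sum_divergence_sq_le (U := fun t a b => A t a b + B t a b)
    fun t => (hA t).add (hB t)
  have hV := two_mul_sum_divergence_sq_le
    (U := fun t a b => (![1, -1, -1, -1] : Fin 4 → ℝ) t * (A t a b + -1 * B t a b))
    fun t => ((hA t).add ((hB t).smul _)).smul _
  have hV' : ∀ j c, (∑ t, twoForm
      (fun a => (![1, -1, -1, -1] : Fin 4 → ℝ) t * (A t a c + -1 * B t a c))
      (fun a => (![1, -1, -1, -1] : Fin 4 → ℝ) t * (A t a c + -1 * B t a c)) t j) ^ 2
      = (∑ t, twoForm (fun a => A t a c + -1 * B t a c)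
        (fun a => -(A t a c + -1 * B t a c)) t j) ^ 2 := by
    intro j c
    rw [sum_twoForm_parity (fun t a => A t a c + -1 * B t a c) j, mul_pow]
    fin_cases j <;> simp
  simp only [hV'] at hV
  have hadd : ∀ c t j, twoForm (fun a => A t a c + B t a c) (fun a => A t a c + B t a c) t j
      = twoForm (fun a => A t a c) (fun a => B t a c) t j
        + twoForm (fun a => B t a c) (fun a => A t a c) t j := by
    intro c t j
    fin_cases t <;> fin_cases j <;> simp [twoForm] <;> ring
  have hsub : ∀ c t j, twoForm (fun a => A t a c + -1 * B t a c)
        (fun a => -(A t a c + -1 * B t a c)) t j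
      = twoForm (fun a => A t a c) (fun a => B t a c) t j
        - twoForm (fun a => B t a c) (fun a => A t a c) t j := by
    intro c t j
    fin_cases t <;> fin_cases j <;> simp [twoForm] <;> ring
  simp only [hadd, Finset.sum_add_distrib] at hU
  simp only [hsub, Finset.sum_sub_distrib] at hV
  have e1 : ∑ t, ∑ a, ∑ b, (A t a b + B t a b) ^ 2
      + ∑ t, ∑ a, ∑ b, ((![1, -1, -1, -1] : Fin 4 → ℝ) t * (A t a b + -1 * B t a b)) ^ 2
      = 2 * ∑ t, ∑ a, ∑ b, (A t a b ^ 2 + B t a b ^ 2) := by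
    simp only [← Finset.sum_add_distrib, Finset.mul_sum]
    refine Finset.sum_congr rfl fun t _ => Finset.sum_congr rfl fun a _ =>
      Finset.sum_congr rfl fun b _ => ?_
    fin_cases t <;> simp <;> ring
  have e2 : ∀ p q : Fin 4 → Fin 3 → ℝ, ∑ j, ∑ c, (p j c + q j c) ^ 2
      + ∑ j, ∑ c, (p j c - q j c) ^ 2 = 2 * ∑ j, ∑ c, (p j c ^ 2 + q j c ^ 2) := by
    intro p q
    simp only [← Finset.sum_add_distrib, Finset.mul_sum]
    refine Finset.sum_congr rfl fun t _ => Finset.sum_congr rfl fun a _ => ?_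
    ring
  have e3 := e2 (fun j c => ∑ t, twoForm (fun a => A t a c) (fun a => B t a c) t j)
    (fun j c => ∑ t, twoForm (fun a => B t a c) (fun a => A t a c) t j)
  rw [← Finset.mul_sum]
  linarith

/-! ### The discriminant argument. -/

/-- The algebraic core of the refined Kato inequality: `X` is `∇W`, `D` is the divergence of
`X`, `v` is `|W| ∇|W|` and `Z` is the divergence of `v ⊗ W`. -/
theorem kato_core {ι κ : Type*} [Fintype ι] [Fintype κ] (X : Fin 4 → ι → ℝ) (W : ι → ℝ)
    (D Z : κ → ℝ) (v : Fin 4 → ℝ) (hv : ∀ s, v s = ∑ I, X s I * W I)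
    (hZ : ∑ K, Z K ^ 2 = 1 / 4 * (∑ s, v s ^ 2) * ∑ I, W I ^ 2)
    (hpos : ∀ c : ℝ, 8 * ∑ K, (D K - c * Z K) ^ 2 ≤ 5 * ∑ s, ∑ I, (X s I - c * (v s * W I)) ^ 2)
    (hW : 0 < ∑ I, W I ^ 2) :
    (∀ k : ℝ, 0 ≤ k → k < 5 / 3 →
      k * ((∑ s, v s ^ 2) / ∑ I, W I ^ 2) - 8 * (k - 1) / (5 - 3 * k) * ∑ K, D K ^ 2
        ≤ ∑ s, ∑ I, X s I ^ 2) ∧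
    (D = 0 → 5 / 3 * ((∑ s, v s ^ 2) / ∑ I, W I ^ 2) ≤ ∑ s, ∑ I, X s I ^ 2) := by
  set n := ∑ s, v s ^ 2 with hn
  set w := ∑ I, W I ^ 2 with hw
  set N := ∑ s, ∑ I, X s I ^ 2 with hN
  set d := ∑ K, D K ^ 2 with hd
  set r := ∑ K, D K * Z K with hr
  have hn0 : 0 ≤ n := Finset.sum_nonneg fun _ _ => sq_nonneg _
  have hd0 : 0 ≤ d := Finset.sum_nonneg fun _ _ => sq_nonneg _
  have hCS : r ^ 2 ≤ d * (1 / 4 * n * w) := by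
    rw [← hZ]
    exact Finset.sum_mul_sq_le_sq_mul_sq _ _ _
  have e1 : ∀ c : ℝ, ∑ K, (D K - c * Z K) ^ 2 = d - 2 * c * r + c ^ 2 * (1 / 4 * n * w) := by
    intro c
    rw [← hZ, hd, hr, Finset.mul_sum, Finset.mul_sum, ← Finset.sum_sub_distrib,
      ← Finset.sum_add_distrib]
    exact Finset.sum_congr rfl fun K _ => by ring
  have e2 : ∀ c : ℝ, ∑ s, ∑ I, (X s I - c * (v s * W I)) ^ 2 = N - 2 * c * n + c ^ 2 * (n * w) := by
    intro c
    rw [hN, hn, Finset.sum_mul, Finset.mul_sum, Finset.mul_sum, ← Finset.sum_sub_distrib,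
      ← Finset.sum_add_distrib]
    refine Finset.sum_congr rfl fun s _ => ?_
    rw [hw, show 2 * c * v s ^ 2 = 2 * c * v s * ∑ I, X s I * W I by rw [← hv]; ring,
      Finset.mul_sum, Finset.mul_sum, Finset.mul_sum, ← Finset.sum_sub_distrib,
      ← Finset.sum_add_distrib]
    exact Finset.sum_congr rfl fun I _ => by ring
  simp only [e1, e2] at hpos
  -- The leading coefficient 3nw is 5nw − 8 · nw/4: the divergence of v ⊗ W falls short of the
  -- extremal ratio 5/8.
  have hdisc : (5 * n - 8 * r) ^ 2 ≤ 3 * (n * w) * (5 * N - 8 * d) := by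
    have := discrim_le_zero (a := 3 * (n * w)) (b := -(2 * (5 * n - 8 * r))) (c := 5 * N - 8 * d)
      fun c => by nlinarith [hpos c]
    rw [discrim] at this
    linarith
  -- The value c = 0. It covers the case n = 0, where the discriminant carries no information.
  have hND : 8 * d ≤ 5 * N := by simpa using hpos 0
  refine ⟨fun k hk0 hk => ?_, fun h => ?_⟩
  · have h5 : 0 < 5 - 3 * k := by linarith
    have h5' := h5.ne'
    have hmain : k * n ≤ (N + 8 * (k - 1) / (5 - 3 * k) * d) * w := by
      rcases hn0.eq_or_lt with h0 | h0
      · rw [← h0, mul_zero]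
        refine mul_nonneg ?_ hW.le
        have : N + 8 * (k - 1) / (5 - 3 * k) * d
            = 1 / 5 * (5 * N - 8 * d) + 16 * k / (5 * (5 - 3 * k)) * d := by
          have hm := mul_inv_cancel₀ h5'
          simp only [div_eq_mul_inv, mul_inv]
          linear_combination (-8 / 5 * d) * hm
        rw [this]
        have : 0 ≤ 16 * k / (5 * (5 - 3 * k)) * d := by positivity
        linarith
      · have key : k * (5 - 3 * k) * n ^ 2 ≤ n * w * ((5 - 3 * k) * N + 8 * (k - 1) * d) := by
          -- With α = 3k, β = 5 − 3k, a = 5n − 8r and b = 8r, so that α + β = 5 and a + b = 5n, this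
          -- is αβ(a + b)² = (α + β)(βa² + αb²) − (βa − αb)². Then a² is bounded by the discriminant
          -- and b² by Cauchy–Schwarz.
          have hid : 75 * (k * (5 - 3 * k) * n ^ 2)
              = 25 * (5 - 3 * k) * (5 * n - 8 * r) ^ 2 / 5 + 15 * k * 64 * r ^ 2 * 5 / 5
                - ((5 - 3 * k) * (5 * n - 8 * r) - 3 * k * (8 * r)) ^ 2 := by
            ring
          nlinarith [mul_le_mul_of_nonneg_left hdisc h5.le, mul_le_mul_of_nonneg_left hCS hk0]
        have : n * (k * n) ≤ n * ((N + 8 * (k - 1) / (5 - 3 * k) * d) * w) := by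
          rw [← mul_le_mul_iff_right₀ h5]
          calc _ = k * (5 - 3 * k) * n ^ 2 := by ring
            _ ≤ _ := key
            _ = _ := by field_simp
        exact le_of_mul_le_mul_left this h0
    have : k * (n / w) ≤ N + 8 * (k - 1) / (5 - 3 * k) * d := by
      rw [← mul_div_assoc, div_le_iff₀ hW]
      exact hmain
    linarith
  · have hd' : d = 0 := by simp [hd, h]
    have hr' : r = 0 := by simp [hr, h]
    rw [hd', hr'] at hdisc
    rw [← mul_div_assoc, div_le_iff₀ hW]
    rcases hn0.eq_or_lt with h0 | h0
    · rw [← h0]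
      nlinarith
    · refine le_of_mul_le_mul_left (a := n) ?_ h0
      nlinarith

/-! ### Passage to an orthonormal frame. -/

/-- Contraction of every index of a covariant tensor with the matrix `E`: the components in the
frame given by the columns of `E`. -/
def pull {n : ℕ} (E : Matrix (Fin 4) (Fin 4) ℝ) (T : Tensor n) : Tensor n := fun K =>
  ∑ I : Fin n → Fin 4, (∏ a, E (I a) (K a)) * T I

/-- Expanding the product over slots of H = E Eᵀ gives one sum over frame multi-indices, which turns
metric contractions into Euclidean ones. -/
theorem sum_mul_mul_eq_sum_pull {n : ℕ} {H E : Matrix (Fin 4) (Fin 4) ℝ}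
    (hE : H = E * E.transpose) (S T : Tensor n) :
    ∑ I : Fin n → Fin 4, ∑ J : Fin n → Fin 4, (∏ a, H (I a) (J a)) * S I * T J
      = ∑ K, pull E S K * pull E T K := by
  have h : ∀ I J : Fin n → Fin 4,
      ∏ a, H (I a) (J a) = ∑ K : Fin n → Fin 4, (∏ a, E (I a) (K a)) * ∏ a, E (J a) (K a) := by
    intro I J
    simp only [hE, Matrix.mul_apply, Matrix.transpose_apply, Fintype.prod_sum,
      Finset.prod_mul_distrib]
  simp only [h, pull, Finset.sum_mul_sum]
  simp only [Finset.sum_mul]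
  rw [Finset.sum_comm (γ := Fin n → Fin 4) (s := (Finset.univ : Finset (Fin n → Fin 4)))
    (t := Finset.univ) (f := fun K I => ∑ J : Fin n → Fin 4,
      (∏ a, E (I a) (K a)) * S I * ((∏ a, E (J a) (K a)) * T J))]
  refine Finset.sum_congr rfl fun I _ => ?_
  rw [Finset.sum_comm]
  exact Finset.sum_congr rfl fun K _ => Finset.sum_congr rfl fun J _ => by ring

theorem normSq_eq_sum_pull {n : ℕ} {G : E4 → Matrix (Fin 4) (Fin 4) ℝ} {y : E4}
    {E : Matrix (Fin 4) (Fin 4) ℝ} (hE : (G y)⁻¹ = E * E.transpose) (T : Tensor n) :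
    normSq G y T = ∑ K, pull E T K ^ 2 := by
  rw [normSq, sum_mul_mul_eq_sum_pull hE]
  exact Finset.sum_congr rfl fun K _ => (sq _).symm

theorem sum_snoc {n : ℕ} (f : (Fin (n + 1) → Fin 4) → ℝ) :
    ∑ I, f I = ∑ s, ∑ I, f (Fin.snoc I s) := by
  rw [← (Fin.snocEquiv fun _ => Fin 4).sum_comp, Fintype.sum_prod_type]
  rfl

theorem sum_vecCons {n : ℕ} (f : (Fin (n + 1) → Fin 4) → ℝ) :
    ∑ I, f I = ∑ s, ∑ I, f (Matrix.vecCons s I) := by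
  rw [← (Fin.consEquiv fun _ => Fin 4).sum_comp, Fintype.sum_prod_type]
  rfl

theorem sum_tensor_zero (f : (Fin 0 → Fin 4) → ℝ) : ∑ I, f I = f ![] := by
  rw [Fintype.sum_unique]
  congr

theorem pull_snoc {n : ℕ} (E : Matrix (Fin 4) (Fin 4) ℝ) (T : Tensor (n + 1)) (K : Fin n → Fin 4)
    (k : Fin 4) :
    pull E T (Fin.snoc K k) = ∑ s, E s k * pull E (fun I => T (Fin.snoc I s)) K := by
  simp only [pull, sum_snoc, Fin.prod_univ_castSucc, Fin.snoc_castSucc, Fin.snoc_last,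
    Finset.mul_sum]
  exact Finset.sum_congr rfl fun s _ => Finset.sum_congr rfl fun I _ => by ring

theorem pull_vecCons {n : ℕ} (E : Matrix (Fin 4) (Fin 4) ℝ) (T : Tensor (n + 1))
    (K : Fin n → Fin 4) (k : Fin 4) :
    pull E T (Matrix.vecCons k K) = ∑ s, E s k * pull E (fun I => T (Matrix.vecCons s I)) K := by
  simp only [pull, sum_vecCons, Fin.prod_univ_succ, Matrix.cons_val_zero, Matrix.cons_val_succ,
    Finset.mul_sum]
  exact Finset.sum_congr rfl fun s _ => Finset.sum_congr rfl fun I _ => by ring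

theorem pull_sum {n : ℕ} {ι : Type*} [Fintype ι] (E : Matrix (Fin 4) (Fin 4) ℝ)
    (c : ι → ℝ) (T : ι → Tensor n) (K : Fin n → Fin 4) :
    pull E (fun I => ∑ t, c t * T t I) K = ∑ t, c t * pull E (T t) K := by
  simp only [pull, Finset.mul_sum]
  rw [Finset.sum_comm]
  exact Finset.sum_congr rfl fun s _ => Finset.sum_congr rfl fun I _ => by ring

/-- A rank-four tensor as a function of its four indices. -/
def curry4 (T : Tensor 4) : Fin 4 → Fin 4 → Fin 4 → Fin 4 → ℝ := fun i j k l => T ![i, j, k, l]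

/-- `pull` for tensors given as functions of four indices. -/
def pull4 (E : Matrix (Fin 4) (Fin 4) ℝ) (T : Fin 4 → Fin 4 → Fin 4 → Fin 4 → ℝ) :
    Fin 4 → Fin 4 → Fin 4 → Fin 4 → ℝ := fun i j k l =>
  ∑ a, ∑ b, ∑ c, ∑ d, E a i * E b j * E c k * E d l * T a b c d

theorem curry4_pull (E : Matrix (Fin 4) (Fin 4) ℝ) (T : Tensor 4) :
    curry4 (pull E T) = pull4 E (curry4 T) := by
  funext i j k l
  simp only [curry4, pull4, pull, sum_vecCons, sum_tensor_zero, Fin.prod_univ_four,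
    Matrix.cons_val]

/-- The two-matrix form H = E K Eᵀ serves both directions: into an orthonormal frame with K = 1, and
back out of it with E⁻¹. -/
theorem IsWeyl.pull4 {H K E : Matrix (Fin 4) (Fin 4) ℝ} {T : Fin 4 → Fin 4 → Fin 4 → Fin 4 → ℝ}
    (h : IsWeyl H T) (hE : H = E * K * E.transpose) : IsWeyl K (pull4 E T) where
  antisymm_left i j k l := by
    rw [KatoWeyl.pull4, KatoWeyl.pull4, Finset.sum_comm]
    simp only [← Finset.sum_neg_distrib]
    refine Finset.sum_congr rfl fun a _ => Finset.sum_congr rfl fun b _ =>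
      Finset.sum_congr rfl fun c _ => Finset.sum_congr rfl fun d _ => ?_
    rw [h.antisymm_left b a]
    ring
  antisymm_right i j k l := by
    simp only [KatoWeyl.pull4, ← Finset.sum_neg_distrib]
    refine Finset.sum_congr rfl fun a _ => Finset.sum_congr rfl fun b _ => ?_
    rw [Finset.sum_comm]
    refine Finset.sum_congr rfl fun c _ => Finset.sum_congr rfl fun d _ => ?_
    rw [h.antisymm_right a b d c]
    ring
  bianchi i j k l := by
    have e1 : ∀ a, ∑ b, ∑ c, ∑ d, E a i * E b k * E c l * E d j * T a b c d
        = ∑ b, ∑ c, ∑ d, E a i * E b j * E c k * E d l * T a c d b := by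
      intro a
      rw [Finset.sum_comm_cycle]
      refine Finset.sum_congr rfl fun b _ => Finset.sum_congr rfl fun c _ =>
        Finset.sum_congr rfl fun d _ => by ring
    have e2 : ∀ a, ∑ b, ∑ c, ∑ d, E a i * E b l * E c j * E d k * T a b c d
        = ∑ b, ∑ c, ∑ d, E a i * E b j * E c k * E d l * T a d b c := by
      intro a
      rw [Finset.sum_comm_cycle, Finset.sum_comm_cycle]
      refine Finset.sum_congr rfl fun b _ => Finset.sum_congr rfl fun c _ =>
        Finset.sum_congr rfl fun d _ => by ring
    simp only [KatoWeyl.pull4, e1, e2, ← Finset.sum_add_distrib, ← mul_add, h.bianchi, mul_zero,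
      Finset.sum_const_zero]
  trace j l := by
    have e : ∀ f : Fin 4 → Fin 4 → Fin 4 → Fin 4 → Fin 4 → Fin 4 → ℝ,
        ∑ i, ∑ k, ∑ a, ∑ b, ∑ c, ∑ d, f i k a b c d = ∑ b, ∑ d, ∑ a, ∑ c, ∑ k, ∑ i, f i k a b c d := by
      intro f
      simp only [← Fintype.sum_prod_type']
      exact Fintype.sum_equiv ⟨fun ⟨i, k, a, b, c, d⟩ => ⟨b, d, a, c, k, i⟩,
        fun ⟨b, d, a, c, k, i⟩ => ⟨i, k, a, b, c, d⟩, fun _ => rfl, fun _ => rfl⟩ _ _ fun _ => rfl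
    calc _ = ∑ b, ∑ d, E b j * E d l * ∑ a, ∑ c, H a c * T a b c d := by
          simp only [KatoWeyl.pull4, Finset.mul_sum, hE, Matrix.mul_apply, Matrix.transpose_apply,
            Finset.sum_mul]
          rw [e]
          refine Finset.sum_congr rfl fun b _ => Finset.sum_congr rfl fun d _ =>
            Finset.sum_congr rfl fun a _ => Finset.sum_congr rfl fun c _ =>
            Finset.sum_congr rfl fun k _ => Finset.sum_congr rfl fun i _ => by ring
      _ = 0 := by simp only [h.trace, mul_zero, Finset.sum_const_zero]

theorem IsWeyl.sum_mul {ι : Type*} [Fintype ι] {H : Matrix (Fin 4) (Fin 4) ℝ} (c : ι → ℝ)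
    {T : ι → Fin 4 → Fin 4 → Fin 4 → Fin 4 → ℝ} (h : ∀ s, IsWeyl H (T s)) :
    IsWeyl H (fun i j k l => ∑ s, c s * T s i j k l) where
  antisymm_left i j k l := by
    simp only [← Finset.sum_neg_distrib, ← mul_neg, ← (h _).antisymm_left i j]
  antisymm_right i j k l := by
    simp only [← Finset.sum_neg_distrib, ← mul_neg, ← (h _).antisymm_right i j k l]
  bianchi i j k l := by
    simp only [← Finset.sum_add_distrib, ← mul_add, (h _).bianchi, mul_zero, Finset.sum_const_zero]
  trace j l := by
    calc ∑ i, ∑ k, H i k * ∑ s, c s * T s i j k l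
        = ∑ i, ∑ k, ∑ s, c s * (H i k * T s i j k l) := by
          refine Finset.sum_congr rfl fun i _ => Finset.sum_congr rfl fun k _ => ?_
          rw [Finset.mul_sum]
          exact Finset.sum_congr rfl fun s _ => mul_left_comm _ _ _
      _ = ∑ s, c s * ∑ i, ∑ k, H i k * T s i j k l := by
          rw [Finset.sum_comm_cycle]
          simp only [Finset.mul_sum]
      _ = 0 := by simp only [(h _).trace, mul_zero, Finset.sum_const_zero]

theorem IsWeyl.sub_mul {H : Matrix (Fin 4) (Fin 4) ℝ} {S T : Fin 4 → Fin 4 → Fin 4 → Fin 4 → ℝ}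
    (hS : IsWeyl H S) (hT : IsWeyl H T) (c : ℝ) :
    IsWeyl H (fun i j k l => S i j k l - c * T i j k l) := by
  have := IsWeyl.sum_mul (T := ![S, T]) ![1, -c] (H := H) (fun s => by fin_cases s <;> assumption)
  simpa [Fin.sum_univ_two, ← sub_eq_add_neg] using this

theorem sum_tensor_four (f : (Fin 4 → Fin 4) → ℝ) :
    ∑ I, f I = ∑ i, ∑ j, ∑ k, ∑ l, f ![i, j, k, l] := by
  simp only [sum_vecCons, sum_tensor_zero]

theorem sum_tensor_three (f : (Fin 3 → Fin 4) → ℝ) :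
    ∑ I, f I = ∑ i, ∑ j, ∑ k, f ![i, j, k] := by
  simp only [sum_vecCons, sum_tensor_zero]

/-- The refined Kato inequality at a point, for a tensor `T` of Weyl type whose covariant
derivative `N` is of Weyl type, `u` being the differential of `|T|`. -/
theorem kato_of_isWeyl {G : E4 → Matrix (Fin 4) (Fin 4) ℝ} {y : E4}
    {E : Matrix (Fin 4) (Fin 4) ℝ} (hE : (G y)⁻¹ = E * E.transpose) {T : Tensor 4} {N : Tensor 5}
    (hT : IsWeyl (G y)⁻¹ (curry4 T))
    (hN : ∀ s, IsWeyl (G y)⁻¹ (curry4 fun I => N (Fin.snoc I s))) {u : Fin 4 → ℝ}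
    (hu : ∀ s, u s * √(normSq G y T) = ∑ I : Fin 4 → Fin 4, ∑ J : Fin 4 → Fin 4,
      (∏ a, (G y)⁻¹ (I a) (J a)) * N (Fin.snoc I s) * T J)
    (hT0 : √(normSq G y T) ≠ 0) :
    (∀ k : ℝ, 0 ≤ k → k < 5 / 3 →
      normSq G y N ≥ k * normSq (n := 1) G y (fun I => u (I 0)) - 8 * (k - 1) / (5 - 3 * k)
        * normSq (n := 3) G y
          (fun I => ∑ t, ∑ s, (G y)⁻¹ t s * N ![t, I 0, I 1, I 2, s])) ∧
    ((fun I : Fin 3 → Fin 4 => ∑ t, ∑ s, (G y)⁻¹ t s * N ![t, I 0, I 1, I 2, s]) = 0 →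
      normSq G y N ≥ 5 / 3 * normSq (n := 1) G y (fun I => u (I 0))) := by
  set D : Tensor 3 := fun I => ∑ t, ∑ s, (G y)⁻¹ t s * N ![t, I 0, I 1, I 2, s] with hD
  -- The derivative direction is converted to the frame as well, so each X k is a linear combination
  -- of Weyl-type tensors.
  set X : Fin 4 → Tensor 4 := fun k K => ∑ s, E s k * pull E (fun I => N (Fin.snoc I s)) K with hX
  set W : Tensor 4 := pull E T with hWdef
  set v : Fin 4 → ℝ := fun k => ∑ I, X k I * W I with hv
  have hE1 : (G y)⁻¹ = E * 1 * E.transpose := by rw [mul_one, hE]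
  have hWW : IsWeyl 1 (curry4 W) := by
    rw [hWdef, curry4_pull]
    exact hT.pull4 hE1
  have hXW : ∀ k, IsWeyl 1 (curry4 (X k)) := by
    intro k
    have := IsWeyl.sum_mul (fun s => E s k) fun s => (hN s).pull4 hE1
    simp only [← curry4_pull] at this
    exact this
  have hnN : normSq G y N = ∑ k, ∑ I, X k I ^ 2 := by
    rw [normSq_eq_sum_pull hE, sum_snoc]
    simp only [pull_snoc, hX]
  have hnT : normSq G y T = ∑ I, W I ^ 2 := normSq_eq_sum_pull hE T
  -- The frame components of the divergence are the Euclidean divergence of X.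
  have hpD : ∀ K : Fin 3 → Fin 4, pull E D K = ∑ k, X k (Matrix.vecCons k K) := by
    intro K
    have hN5 : ∀ (t s : Fin 4) (I : Fin 3 → Fin 4),
        (![t, I 0, I 1, I 2, s] : Fin 5 → Fin 4) = Fin.snoc (Matrix.vecCons t I : Fin 4 → Fin 4) s := by
      intro t s I
      funext a
      fin_cases a <;> rfl
    have hD' : D = fun I => ∑ p : Fin 4 × Fin 4 × Fin 4, (E p.2.2 p.1 * E p.2.1 p.1)
        * N (Fin.snoc (Matrix.vecCons p.2.2 I : Fin 4 → Fin 4) p.2.1) := by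
      funext I
      simp only [hD, hN5, hE, Matrix.mul_apply, Matrix.transpose_apply, Fintype.sum_prod_type,
        Finset.sum_mul]
      rw [Finset.sum_comm_cycle]
      exact Finset.sum_congr rfl fun k _ => Finset.sum_comm
    rw [hD', pull_sum]
    simp only [hX, pull_vecCons, Fintype.sum_prod_type, Finset.mul_sum]
    exact Finset.sum_congr rfl fun k _ => Finset.sum_congr rfl fun s _ =>
      Finset.sum_congr rfl fun t _ => by ring
  have hvu : ∀ k, v k = √(normSq G y T) * ∑ s, E s k * u s := by
    intro k
    rw [Finset.mul_sum, hv]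
    simp only [hX, Finset.sum_mul]
    rw [Finset.sum_comm]
    refine Finset.sum_congr rfl fun s _ => ?_
    rw [mul_left_comm, mul_comm (√_), hu, sum_mul_mul_eq_sum_pull hE, Finset.mul_sum]
    exact Finset.sum_congr rfl fun I _ => mul_assoc _ _ _
  have hW0 : 0 < ∑ I, W I ^ 2 := by
    rw [← hnT]
    exact Real.sqrt_ne_zero'.1 hT0
  -- Since v = |T| u in the frame, |u|² = |v|² / |T|².
  have hnu : normSq (n := 1) G y (fun I => u (I 0)) = (∑ k, v k ^ 2) / ∑ I, W I ^ 2 := by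
    rw [eq_div_iff hW0.ne', normSq_eq_sum_pull hE]
    simp only [hvu, mul_pow, ← Finset.mul_sum]
    rw [Real.sq_sqrt (hnT ▸ hW0.le), hnT, mul_comm]
    simp only [sum_vecCons, sum_tensor_zero, pull_vecCons]
    simp [pull]
  have := kato_core X W (pull E D) (fun K => ∑ k, v k * W (Matrix.vecCons k K)) v (fun _ => rfl)
    ?_ ?_ hW0
  · simp only [hnN, hnu, normSq_eq_sum_pull hE D, ge_iff_le]
    refine ⟨this.1, fun h => this.2 ?_⟩
    rw [h]
    funext K
    simp [pull]
  · rw [sum_tensor_three, sum_tensor_four]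
    exact hWW.sum_contract_sq v
  · intro c
    have := eight_mul_sum_divergence_sq_le fun k => (hXW k).sub_mul hWW (c * v k)
    rw [sum_tensor_three]
    simp only [sum_tensor_four, hpD]
    refine le_of_eq_of_le ?_ (this.trans_eq ?_)
    · congr! 8
      simp only [Finset.sum_sub_distrib, Finset.mul_sum, curry4, mul_assoc]
    · simp only [curry4, mul_assoc]

theorem pull_pull {n : ℕ} (E F : Matrix (Fin 4) (Fin 4) ℝ) (T : Tensor n) :
    pull F (pull E T) = pull (E * F) T := by
  funext K
  simp only [pull, Matrix.mul_apply, Fintype.prod_sum, Finset.prod_mul_distrib, Finset.mul_sum,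
    Finset.sum_mul]
  rw [Finset.sum_comm]
  exact Finset.sum_congr rfl fun I _ => Finset.sum_congr rfl fun J _ => by ring

theorem pull_one {n : ℕ} (T : Tensor n) : pull 1 T = T := by
  funext K
  rw [pull, Finset.sum_eq_single K]
  · simp
  · intro I _ hI
    obtain ⟨a, ha⟩ := Function.ne_iff.1 hI
    have h0 : ∏ a, (1 : Matrix (Fin 4) (Fin 4) ℝ) (I a) (K a) = 0 :=
      Finset.prod_eq_zero (Finset.mem_univ a) (Matrix.one_apply_ne ha)
    exact mul_eq_zero_of_left h0 _
  · simp

theorem isWeyl_of_pull {H E : Matrix (Fin 4) (Fin 4) ℝ} (hE : H = E * E.transpose)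
    (hdet : IsUnit E.det) {T : Tensor 4} (h : IsWeyl 1 (curry4 (pull E T))) :
    IsWeyl H (curry4 T) := by
  have e : T = pull E⁻¹ (pull E T) := by
    rw [pull_pull, E.mul_nonsing_inv hdet, pull_one]
  rw [e, curry4_pull]
  refine h.pull4 ?_
  rw [hE, Matrix.transpose_nonsing_inv, ← Matrix.mul_assoc, E.nonsing_inv_mul hdet, one_mul,
    Matrix.mul_nonsing_inv]
  rwa [Matrix.det_transpose]

/-! ### The Hodge star and the half Weyl tensor in a frame. -/

/-- The Levi-Civita symbol. -/
def epsilon (i j k l : Fin 4) : ℝ :=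
  ((1 : Matrix (Fin 4) (Fin 4) ℝ).submatrix ![i, j, k, l] id).det

theorem volumeForm_eq (G : E4 → Matrix (Fin 4) (Fin 4) ℝ) (y : E4) (i j k l : Fin 4) :
    volumeForm G y i j k l = √(G y).det * epsilon i j k l := rfl

/-- Each row of the product with Eᵀ is a combination of standard basis rows; expand the determinant
multilinearly and compare with its multiplicativity. -/
theorem pull_det (E : Matrix (Fin 4) (Fin 4) ℝ) (K : Fin 4 → Fin 4) :
    pull E (fun I => ((1 : Matrix (Fin 4) (Fin 4) ℝ).submatrix I id).det) K
      = E.det * ((1 : Matrix (Fin 4) (Fin 4) ℝ).submatrix K id).det := by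
  have h : (1 : Matrix (Fin 4) (Fin 4) ℝ).submatrix K id * E.transpose
      = fun r => ∑ i, E i (K r) • (1 : Matrix (Fin 4) (Fin 4) ℝ) i := by
    ext r c
    simp [Matrix.mul_apply, Matrix.one_apply]
  rw [mul_comm, ← E.det_transpose, ← Matrix.det_mul, h]
  change _ = (Matrix.detRowAlternating (R := ℝ)).toMultilinearMap _
  rw [MultilinearMap.map_sum]
  simp only [MultilinearMap.map_smul_univ]
  rfl

theorem pull4_epsilon (E : Matrix (Fin 4) (Fin 4) ℝ) (i j k l : Fin 4) :
    pull4 E epsilon i j k l = E.det * epsilon i j k l := by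
  rw [epsilon, ← pull_det]
  exact (congr_fun (congr_fun (congr_fun (congr_fun (curry4_pull E
    (fun I => ((1 : Matrix (Fin 4) (Fin 4) ℝ).submatrix I id).det)) i) j) k) l).symm

/-- `pull` for tensors given as functions of two indices. -/
def pull2 (E : Matrix (Fin 4) (Fin 4) ℝ) (η : Fin 4 → Fin 4 → ℝ) : Fin 4 → Fin 4 → ℝ :=
  fun i j => ∑ a, ∑ b, E a i * E b j * η a b

/-- The Hodge star of the Euclidean metric. -/
def flatStar (η : Fin 4 → Fin 4 → ℝ) (i j : Fin 4) : ℝ :=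
  1 / 2 * ∑ a, ∑ b, epsilon i j a b * η a b

/-- The factor √(det G) · det E is ±1, the orientation of the frame. Its value is never needed,
because the projections below are treated with an arbitrary coefficient c. -/
theorem pull2_hodgeStar {G : E4 → Matrix (Fin 4) (Fin 4) ℝ} {y : E4}
    {E : Matrix (Fin 4) (Fin 4) ℝ} (hE : (G y)⁻¹ = E * E.transpose) (η : Fin 4 → Fin 4 → ℝ)
    (i j : Fin 4) :
    pull2 E (hodgeStar G y η) i j = √(G y).det * E.det * flatStar (pull2 E η) i j := by
  have e : ∀ f : Fin 4 → Fin 4 → Fin 4 → Fin 4 → Fin 4 → Fin 4 → Fin 4 → Fin 4 → ℝ,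
      ∑ a, ∑ b, ∑ p, ∑ q, ∑ r, ∑ t, ∑ n, ∑ m, f a b p q r t n m
        = ∑ m, ∑ n, ∑ r, ∑ t, ∑ a, ∑ b, ∑ p, ∑ q, f a b p q r t n m := by
    intro f
    simp only [← Fintype.sum_prod_type']
    exact Fintype.sum_equiv ⟨fun ⟨a, b, p, q, r, t, n, m⟩ => ⟨m, n, r, t, a, b, p, q⟩,
      fun ⟨m, n, r, t, a, b, p, q⟩ => ⟨a, b, p, q, r, t, n, m⟩, fun _ => rfl, fun _ => rfl⟩ _ _
      fun _ => rfl
  have h : ∀ k l, E.det * epsilon i j k l = ∑ a, ∑ b, ∑ c, ∑ d,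
      E a i * E b j * E c k * E d l * epsilon a b c d := fun k l => (pull4_epsilon E i j k l).symm
  calc _ = ∑ a, ∑ b, ∑ p, ∑ q, ∑ r, ∑ t, ∑ n, ∑ m, 1 / 2 * √(G y).det *
        ((E a i * E b j * E p m * E q n * epsilon a b p q) * (E r m * E t n * η r t)) := by
        simp only [pull2, hodgeStar, volumeForm_eq, hE, Matrix.mul_apply,
          Matrix.transpose_apply, Finset.mul_sum, Finset.sum_mul]
        repeat' refine Finset.sum_congr rfl fun _ _ => ?_
        ring
    _ = _ := by
        rw [e]
        simp only [← Finset.mul_sum, ← Finset.sum_mul, ← h, flatStar, pull2]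
        simp only [Finset.mul_sum]
        repeat' refine Finset.sum_congr rfl fun _ _ => ?_
        ring

/-- Selecting rows of the Vandermonde matrix of 0, 1, 2, 3, whose determinant is 12, gives the
Vandermonde matrix of the indices. The resulting polynomial formula makes case checks computable. -/
theorem epsilon_eq (i j k l : Fin 4) :
    epsilon i j k l = ((j.val : ℝ) - i.val) * (k.val - i.val) * (l.val - i.val) * (k.val - j.val)
      * (l.val - j.val) * (l.val - k.val) / 12 := by
  have h : (1 : Matrix (Fin 4) (Fin 4) ℝ).submatrix ![i, j, k, l] id
      * Matrix.vandermonde ![0, 1, 2, 3]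
      = Matrix.vandermonde fun r => ((![i, j, k, l] r).val : ℝ) := by
    ext r c
    have : ∀ m : Fin 4, (![0, 1, 2, 3] : Fin 4 → ℝ) m = m.val := by
      intro m
      fin_cases m <;> simp
    simp only [Matrix.mul_apply, Matrix.submatrix_apply, Matrix.one_apply,
      Matrix.vandermonde_apply, id, this, ite_mul, one_mul, zero_mul, Finset.sum_ite_eq,
      Finset.mem_univ, if_true]
  have hd := congr_arg Matrix.det h
  rw [Matrix.det_mul, Matrix.det_vandermonde, Matrix.det_vandermonde, ← epsilon] at hd
  have hI : ∀ f : Fin 4 → Fin 4 → ℝ, ∏ i, ∏ j ∈ Finset.Ioi i, f i j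
      = f 0 1 * f 0 2 * f 0 3 * (f 1 2 * f 1 3) * f 2 3 := by
    intro f
    rw [Fin.prod_univ_four, show Finset.Ioi (0 : Fin 4) = {1, 2, 3} by decide,
      show Finset.Ioi (1 : Fin 4) = {2, 3} by decide, show Finset.Ioi (2 : Fin 4) = {3} by decide,
      show Finset.Ioi (3 : Fin 4) = ∅ by decide]
    simp [mul_assoc]
  simp only [hI, Matrix.cons_val] at hd
  linear_combination hd / 12

theorem flatStar_twoForm (x u : Fin 3 → ℝ) : flatStar (twoForm x u) = twoForm u x := by
  funext i j
  rw [flatStar]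
  simp only [Fin.sum_univ_four, twoForm, Matrix.cons_val, epsilon_eq]
  fin_cases i <;> fin_cases j <;> simp <;> ring


/-- The projection `(1 + c ⋆) / 2` for the Euclidean metric. -/
def flatProj (c : ℝ) (η : Fin 4 → Fin 4 → ℝ) (i j : Fin 4) : ℝ :=
  1 / 2 * (η i j + c * flatStar η i j)

theorem flatProj_twoForm (c : ℝ) (x u : Fin 3 → ℝ) :
    flatProj c (twoForm x u)
      = twoForm (fun a => 1 / 2 * (x a + c * u a)) (fun a => 1 / 2 * (u a + c * x a)) := by
  funext i j
  rw [flatProj, flatStar_twoForm]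
  fin_cases i <;> fin_cases j <;> simp [twoForm] <;> ring

theorem flatProj_weylOf (c : ℝ) (A B : Fin 3 → Fin 3 → ℝ) (i j : Fin 4) :
    flatProj c (weylOf A B i j) = weylOf (fun a b => 1 / 2 * (A a b + c * B a b))
      (fun a b => 1 / 2 * (B a b + c * A a b)) i j := by
  have h : ∀ A B : Fin 3 → Fin 3 → ℝ, weylOf A B i j
      = twoForm (fun c => twoForm (fun a => A a c) (fun a => B a c) i j)
      (fun c => twoForm (fun a => B a c) (fun a => A a c) i j) := by
    intro A B
    funext k l
    exact weylOf_eq_twoForm A B i j k l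
  rw [h, h, flatProj_twoForm]
  congr 1 <;> funext b <;> fin_cases i <;> fin_cases j <;> simp [twoForm] <;> ring

/-- Projecting the second pair replaces (A, B) by symmetric trace-free combinations of A and B, so
Weyl type survives; pair symmetry then lets the same computation handle the first pair. This works
for every c. -/
theorem IsWeyl.flatProj_flatProj (c : ℝ) {T : Fin 4 → Fin 4 → Fin 4 → Fin 4 → ℝ}
    (h : IsWeyl 1 T) :
    IsWeyl 1 (fun i j k l => flatProj c (fun i j => flatProj c (T i j) k l) i j) := by
  obtain ⟨A, B, hA, hB, rfl⟩ := h.exists_eq_weylOf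
  have hs : ∀ {A B : Fin 3 → Fin 3 → ℝ}, SymmTraceless A → SymmTraceless B →
      SymmTraceless (fun a b => 1 / 2 * (A a b + c * B a b)) := fun hA hB =>
    (hA.add (hB.smul c)).smul (1 / 2)
  have h1 := isWeyl_weylOf (hs hA hB) (hs hB hA)
  have h2 := isWeyl_weylOf (hs (hs hA hB) (hs hB hA)) (hs (hs hB hA) (hs hA hB))
  convert h2 using 1
  funext i j k l
  simp only [flatProj_weylOf]
  rw [show (fun i j => weylOf _ _ i j k l) = weylOf _ _ k l from
    funext fun i => funext fun j => h1.pair_symm i j k l, flatProj_weylOf]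
  exact h2.pair_symm k l i j

theorem flatStar_sum {ι : Type*} [Fintype ι] (d : ι → ℝ) (η : ι → Fin 4 → Fin 4 → ℝ)
    (i j : Fin 4) :
    flatStar (fun a b => ∑ t, d t * η t a b) i j = ∑ t, d t * flatStar (η t) i j := by
  simp only [flatStar, Finset.mul_sum]
  rw [Finset.sum_comm_cycle]
  repeat' refine Finset.sum_congr rfl fun _ _ => ?_
  ring

theorem flatProj_sum {ι : Type*} [Fintype ι] (c : ℝ) (d : ι → ℝ) (η : ι → Fin 4 → Fin 4 → ℝ)
    (i j : Fin 4) :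
    flatProj c (fun a b => ∑ t, d t * η t a b) i j = ∑ t, d t * flatProj c (η t) i j := by
  rw [flatProj, flatStar_sum, Finset.mul_sum, ← Finset.sum_add_distrib, Finset.mul_sum]
  exact Finset.sum_congr rfl fun _ _ => by rw [flatProj]; ring

theorem pull2_halfProj {G : E4 → Matrix (Fin 4) (Fin 4) ℝ} {y : E4}
    {E : Matrix (Fin 4) (Fin 4) ℝ} (hE : (G y)⁻¹ = E * E.transpose) (s : ℤˣ)
    (η : Fin 4 → Fin 4 → ℝ) :
    pull2 E (halfProj s G y η)
      = flatProj (((s : ℤ) : ℝ) * (√(G y).det * E.det)) (pull2 E η) := by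
  funext i j
  rw [flatProj, mul_assoc, ← pull2_hodgeStar hE]
  simp only [pull2, halfProj, Finset.mul_sum, ← Finset.sum_add_distrib]
  repeat' refine Finset.sum_congr rfl fun _ _ => ?_
  ring

theorem pull2_eq_sum_prod (E : Matrix (Fin 4) (Fin 4) ℝ) (η : Fin 4 → Fin 4 → ℝ)
    (i j : Fin 4) : pull2 E η i j = ∑ p : Fin 4 × Fin 4, E p.1 i * E p.2 j * η p.1 p.2 := by
  rw [pull2, Fintype.sum_prod_type]

theorem pull4_eq_pull2 (E : Matrix (Fin 4) (Fin 4) ℝ) (T : Fin 4 → Fin 4 → Fin 4 → Fin 4 → ℝ)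
    (i j k l : Fin 4) : pull4 E T i j k l = pull2 E (fun a b => pull2 E (T a b) k l) i j := by
  simp only [pull4, pull2, Finset.mul_sum]
  repeat' refine Finset.sum_congr rfl fun _ _ => ?_
  ring

theorem pull2_comm (E : Matrix (Fin 4) (Fin 4) ℝ) (T : Fin 4 → Fin 4 → Fin 4 → Fin 4 → ℝ)
    (i j k l : Fin 4) : pull2 E (fun a b => pull2 E (T a b) k l) i j
      = pull2 E (fun c d => pull2 E (fun a b => T a b c d) i j) k l := by
  simp only [pull2_eq_sum_prod, Finset.mul_sum]
  rw [Finset.sum_comm]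
  repeat' refine Finset.sum_congr rfl fun _ _ => ?_
  ring

theorem pull4_halfProj {G : E4 → Matrix (Fin 4) (Fin 4) ℝ} {y : E4}
    {E : Matrix (Fin 4) (Fin 4) ℝ} (hE : (G y)⁻¹ = E * E.transpose) (s : ℤˣ)
    (T : Fin 4 → Fin 4 → Fin 4 → Fin 4 → ℝ) :
    pull4 E (fun i j k l => halfProj s G y (fun a b => halfProj s G y (T a b) k l) i j)
      = fun i j k l => flatProj (((s : ℤ) : ℝ) * (√(G y).det * E.det))
        (fun i j => flatProj (((s : ℤ) : ℝ) * (√(G y).det * E.det)) (pull4 E T i j) k l) i j := by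
  funext i j k l
  rw [pull4_eq_pull2, pull2_comm]
  have h1 : ∀ c d, pull2 E (fun i j => halfProj s G y (fun a b => halfProj s G y (T a b) c d) i j)
      = flatProj (((s : ℤ) : ℝ) * (√(G y).det * E.det))
        (pull2 E fun a b => halfProj s G y (T a b) c d) := fun c d => pull2_halfProj hE s _
  simp only [h1]
  rw [pull2_eq_sum_prod, ← flatProj_sum]
  congr 1
  funext a b
  rw [← pull2_eq_sum_prod E (fun c d => pull2 E (fun a b => halfProj s G y (T a b) c d) a b),
    ← pull2_comm]
  have h2 : ∀ a b, pull2 E (fun c d => halfProj s G y (T a b) c d)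
      = flatProj (((s : ℤ) : ℝ) * (√(G y).det * E.det)) (pull2 E (T a b)) :=
    fun a b => pull2_halfProj hE s _
  simp only [h2]
  rw [pull2_eq_sum_prod, ← flatProj_sum]
  congr 1
  funext c d
  rw [pull4_eq_pull2, pull2_eq_sum_prod]

theorem isWeyl_halfWeyl {G : E4 → Matrix (Fin 4) (Fin 4) ℝ} {y : E4}
    {E : Matrix (Fin 4) (Fin 4) ℝ} (hE : (G y)⁻¹ = E * E.transpose) (hdet : IsUnit E.det)
    (s : ℤˣ) (h : IsWeyl (G y)⁻¹ (weyl G y)) : IsWeyl (G y)⁻¹ (curry4 (halfWeyl s G y)) := by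
  refine isWeyl_of_pull hE hdet ?_
  rw [curry4_pull]
  have : curry4 (halfWeyl s G y)
      = fun i j k l => halfProj s G y (fun a b => halfProj s G y (weyl G y a b) k l) i j := rfl
  rw [this, pull4_halfProj hE]
  exact (h.pull4 (by rw [mul_one, hE])).flatProj_flatProj _

/-! ### Partial derivatives and smoothness of the coordinate tensors. -/

/-- `G` is a smooth Riemannian metric on the open set `U`. -/
structure IsMetricOn (G : E4 → Matrix (Fin 4) (Fin 4) ℝ) (U : Set E4) : Prop where
  isOpen : IsOpen U
  smooth : ∀ i j, ContDiffOn ℝ ∞ (fun y => G y i j) U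
  posDef : ∀ y ∈ U, (G y).PosDef

theorem pderiv_add {f g : E4 → ℝ} {y : E4} (t : Fin 4) (hf : DifferentiableAt ℝ f y)
    (hg : DifferentiableAt ℝ g y) :
    pderiv t (fun z => f z + g z) y = pderiv t f y + pderiv t g y := by
  simp [pderiv, fderiv_fun_add hf hg]

theorem pderiv_sub {f g : E4 → ℝ} {y : E4} (t : Fin 4) (hf : DifferentiableAt ℝ f y)
    (hg : DifferentiableAt ℝ g y) :
    pderiv t (fun z => f z - g z) y = pderiv t f y - pderiv t g y := by
  simp [pderiv, fderiv_fun_sub hf hg]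

theorem pderiv_neg {f : E4 → ℝ} {y : E4} (t : Fin 4) :
    pderiv t (fun z => -f z) y = -pderiv t f y := by
  simp [pderiv, fderiv_fun_neg]

theorem pderiv_mul {f g : E4 → ℝ} {y : E4} (t : Fin 4) (hf : DifferentiableAt ℝ f y)
    (hg : DifferentiableAt ℝ g y) :
    pderiv t (fun z => f z * g z) y = f y * pderiv t g y + g y * pderiv t f y := by
  simp [pderiv, fderiv_fun_mul hf hg]

theorem pderiv_const_mul {f : E4 → ℝ} {y : E4} (t : Fin 4) (c : ℝ)
    (hf : DifferentiableAt ℝ f y) : pderiv t (fun z => c * f z) y = c * pderiv t f y := by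
  simp [pderiv, fderiv_const_mul hf]

theorem pderiv_sum {ι : Type*} [Fintype ι] {f : ι → E4 → ℝ} {y : E4} (t : Fin 4)
    (hf : ∀ i, DifferentiableAt ℝ (f i) y) :
    pderiv t (fun z => ∑ i, f i z) y = ∑ i, pderiv t (f i) y := by
  simp [pderiv, fderiv_fun_sum fun i _ => hf i]

theorem pderiv_congr {f g : E4 → ℝ} {U : Set E4} (hU : IsOpen U) (h : ∀ z ∈ U, f z = g z) {y : E4}
    (hy : y ∈ U) (t : Fin 4) : pderiv t f y = pderiv t g y := by
  rw [pderiv, pderiv, (Filter.eventuallyEq_of_mem (hU.mem_nhds hy) h).fderiv_eq]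

theorem pderiv_const (c : ℝ) (y : E4) (t : Fin 4) : pderiv t (fun _ => c) y = 0 := by
  simp [pderiv]

theorem contDiffOn_pderiv {f : E4 → ℝ} {U : Set E4} (hU : IsOpen U) (h : ContDiffOn ℝ ∞ f U)
    (t : Fin 4) : ContDiffOn ℝ ∞ (pderiv t f) U :=
  (h.fderiv_of_isOpen hU (by simp)).clm_apply contDiffOn_const

theorem differentiableAt_of_contDiffOn {f : E4 → ℝ} {U : Set E4} (hU : IsOpen U)
    (h : ContDiffOn ℝ ∞ f U) {y : E4} (hy : y ∈ U) : DifferentiableAt ℝ f y :=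
  (h.contDiffAt (hU.mem_nhds hy)).differentiableAt (by simp)

theorem pderiv_comm {f : E4 → ℝ} {U : Set E4} (hU : IsOpen U) (h : ContDiffOn ℝ ∞ f U) {y : E4}
    (hy : y ∈ U) (s t : Fin 4) : pderiv s (pderiv t f) y = pderiv t (pderiv s f) y := by
  have hd : DifferentiableAt ℝ (fderiv ℝ f) y :=
    ((h.fderiv_of_isOpen hU (m := ∞) (by simp)).contDiffAt (hU.mem_nhds hy)).differentiableAt
      (by simp)
  have e : ∀ s t, pderiv s (pderiv t f) y
      = fderiv ℝ (fderiv ℝ f) y (EuclideanSpace.single s 1) (EuclideanSpace.single t 1) := by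
    intro s t
    have : pderiv t f = fun z => fderiv ℝ f z (EuclideanSpace.single t 1) := rfl
    rw [pderiv, this, fderiv_clm_apply hd (differentiableAt_const _)]
    simp
  rw [e, e]
  exact ((h.contDiffAt (hU.mem_nhds hy)).isSymmSndFDerivAt
    (by simpa using WithTop.coe_le_coe.2 (le_top : (2 : ℕ∞) ≤ ⊤))) _ _

theorem contDiffOn_det {A : E4 → Matrix (Fin 4) (Fin 4) ℝ} {U : Set E4}
    (h : ∀ i j, ContDiffOn ℝ ∞ (fun y => A y i j) U) : ContDiffOn ℝ ∞ (fun y => (A y).det) U := by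
  simp only [Matrix.det_apply']
  exact ContDiffOn.sum fun σ _ => contDiffOn_const.mul (contDiffOn_prod fun i _ => h _ _)

namespace IsMetricOn

variable {G : E4 → Matrix (Fin 4) (Fin 4) ℝ} {U : Set E4} (hG : IsMetricOn G U)
include hG

theorem det_pos {y : E4} (hy : y ∈ U) : 0 < (G y).det := (hG.posDef y hy).det_pos

theorem symm {y : E4} (hy : y ∈ U) (i j : Fin 4) : G y i j = G y j i := by
  simpa using ((hG.posDef y hy).isHermitian.apply i j).symm

theorem inv_symm {y : E4} (hy : y ∈ U) (i j : Fin 4) : (G y)⁻¹ i j = (G y)⁻¹ j i := by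
  simpa using ((hG.posDef y hy).isHermitian.inv.apply i j).symm

theorem sum_inv_mul {y : E4} (hy : y ∈ U) (i k : Fin 4) :
    ∑ j, (G y)⁻¹ i j * G y j k = if i = k then 1 else 0 := by
  rw [← Matrix.mul_apply, Matrix.nonsing_inv_mul _ (hG.det_pos hy).ne'.isUnit, Matrix.one_apply]

theorem sum_mul_inv {y : E4} (hy : y ∈ U) (i k : Fin 4) :
    ∑ j, G y i j * (G y)⁻¹ j k = if i = k then 1 else 0 := by
  rw [← Matrix.mul_apply, Matrix.mul_nonsing_inv _ (hG.det_pos hy).ne'.isUnit, Matrix.one_apply]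

theorem contDiffOn_inv (i j : Fin 4) : ContDiffOn ℝ ∞ (fun y => (G y)⁻¹ i j) U := by
  have h : ∀ y, (G y)⁻¹ i j = (G y).det⁻¹ * ((G y).updateRow j (Pi.single i 1)).det := by
    intro y
    rw [Matrix.inv_def, Matrix.smul_apply, Matrix.adjugate_apply, Ring.inverse_eq_inv', smul_eq_mul]
  simp only [h]
  refine ((contDiffOn_det hG.smooth).inv fun y hy => (hG.det_pos hy).ne').mul
    (contDiffOn_det fun a b => ?_)
  by_cases hab : a = j
  · subst hab
    simpa using contDiffOn_const
  · simpa [Matrix.updateRow_ne hab] using hG.smooth a b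

theorem contDiffOn_christoffel (m i j : Fin 4) :
    ContDiffOn ℝ ∞ (fun y => christoffel G y m i j) U :=
  contDiffOn_const.mul (ContDiffOn.sum fun l _ => (hG.contDiffOn_inv m l).mul
    (((contDiffOn_pderiv hG.isOpen (hG.smooth j l) i).add
      (contDiffOn_pderiv hG.isOpen (hG.smooth i l) j)).sub
      (contDiffOn_pderiv hG.isOpen (hG.smooth i j) l)))

theorem contDiffOn_curvature (l i j k : Fin 4) :
    ContDiffOn ℝ ∞ (fun y => curvature G y l i j k) U := by
  have hc := hG.contDiffOn_christoffel
  exact ((contDiffOn_pderiv hG.isOpen (hc l k i) j).sub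
    (contDiffOn_pderiv hG.isOpen (hc l j i) k)).add
    (ContDiffOn.sum fun m _ => ((hc l j m).mul (hc m k i)).sub ((hc l k m).mul (hc m j i)))

theorem contDiffOn_riemann (i j k l : Fin 4) : ContDiffOn ℝ ∞ (fun y => riemann G y i j k l) U :=
  ContDiffOn.sum fun m _ => (hG.smooth i m).mul (hG.contDiffOn_curvature m j k l)

theorem contDiffOn_ricci (i k : Fin 4) : ContDiffOn ℝ ∞ (fun y => ricci G y i k) U :=
  ContDiffOn.sum fun j _ => ContDiffOn.sum fun l _ =>
    (hG.contDiffOn_inv j l).mul (hG.contDiffOn_riemann i j k l)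

theorem contDiffOn_scalarCurvature : ContDiffOn ℝ ∞ (fun y => scalarCurvature G y) U :=
  ContDiffOn.sum fun i _ => ContDiffOn.sum fun k _ =>
    (hG.contDiffOn_inv i k).mul (hG.contDiffOn_ricci i k)

theorem contDiffOn_weyl (i j k l : Fin 4) : ContDiffOn ℝ ∞ (fun y => weyl G y i j k l) U := by
  have hr := hG.contDiffOn_ricci
  have hg := hG.smooth
  exact ((hG.contDiffOn_riemann i j k l).sub (contDiffOn_const.mul
    (((((hr i k).mul (hg j l)).sub ((hr i l).mul (hg j k))).add ((hr j l).mul (hg i k))).sub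
      ((hr j k).mul (hg i l))))).add
    ((hG.contDiffOn_scalarCurvature.div_const 6).mul
      (((hg i k).mul (hg j l)).sub ((hg i l).mul (hg j k))))

theorem contDiffOn_halfProj (s : ℤˣ) {η : E4 → Fin 4 → Fin 4 → ℝ}
    (h : ∀ i j, ContDiffOn ℝ ∞ (fun y => η y i j) U) (i j : Fin 4) :
    ContDiffOn ℝ ∞ (fun y => halfProj s G y (η y) i j) U := by
  have hv : ∀ i j k l, ContDiffOn ℝ ∞ (fun y => volumeForm G y i j k l) U := fun i j k l =>
    ((contDiffOn_det hG.smooth).sqrt fun y hy => (hG.det_pos hy).ne').mul contDiffOn_const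
  exact contDiffOn_const.mul ((h i j).add (contDiffOn_const.mul (contDiffOn_const.mul
    (ContDiffOn.sum fun a _ => ContDiffOn.sum fun b _ => ContDiffOn.sum fun c _ =>
      ContDiffOn.sum fun d _ => (((hv i j a b).mul (hG.contDiffOn_inv a c)).mul
        (hG.contDiffOn_inv b d)).mul (h c d)))))

theorem contDiffOn_halfWeyl (s : ℤˣ) (I : Fin 4 → Fin 4) :
    ContDiffOn ℝ ∞ (fun y => halfWeyl s G y I) U :=
  hG.contDiffOn_halfProj s (fun a b => hG.contDiffOn_halfProj s
    (fun c d => hG.contDiffOn_weyl a b c d) (I 2) (I 3)) (I 0) (I 1)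

end IsMetricOn

/-! ### Symmetries of the Riemann and Weyl tensors in coordinates. -/

/-- The Christoffel symbols of the first kind, `g_{am} Γ^m_{ij}`. -/
def christoffelFirst (G : E4 → Matrix (Fin 4) (Fin 4) ℝ) (y : E4) (a i j : Fin 4) : ℝ :=
  1 / 2 * (pderiv i (fun z => G z j a) y + pderiv j (fun z => G z i a) y
    - pderiv a (fun z => G z i j) y)

theorem christoffel_eq (G : E4 → Matrix (Fin 4) (Fin 4) ℝ) (y : E4) (m i j : Fin 4) :
    christoffel G y m i j = ∑ l, (G y)⁻¹ m l * christoffelFirst G y l i j := by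
  rw [christoffel, Finset.mul_sum]
  exact Finset.sum_congr rfl fun l _ => by rw [christoffelFirst]; ring

theorem riemann_antisymm_right (G : E4 → Matrix (Fin 4) (Fin 4) ℝ) (y : E4) (a i j k : Fin 4) :
    riemann G y a i j k = -riemann G y a i k j := by
  simp only [riemann, ← Finset.sum_neg_distrib]
  refine Finset.sum_congr rfl fun m _ => ?_
  simp only [curvature, Finset.sum_sub_distrib]
  ring

namespace IsMetricOn

variable {G : E4 → Matrix (Fin 4) (Fin 4) ℝ} {U : Set E4} (hG : IsMetricOn G U)
include hG

theorem pderiv_symm {y : E4} (hy : y ∈ U) (t i j : Fin 4) :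
    pderiv t (fun z => G z i j) y = pderiv t (fun z => G z j i) y :=
  pderiv_congr hG.isOpen (fun _ hz => hG.symm hz i j) hy t

theorem differentiableAt {y : E4} (hy : y ∈ U) (i j : Fin 4) :
    DifferentiableAt ℝ (fun z => G z i j) y :=
  differentiableAt_of_contDiffOn hG.isOpen (hG.smooth i j) hy

theorem differentiableAt_christoffel {y : E4} (hy : y ∈ U) (m i j : Fin 4) :
    DifferentiableAt ℝ (fun z => christoffel G z m i j) y :=
  differentiableAt_of_contDiffOn hG.isOpen (hG.contDiffOn_christoffel m i j) hy

theorem christoffelFirst_symm {y : E4} (hy : y ∈ U) (a i j : Fin 4) :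
    christoffelFirst G y a i j = christoffelFirst G y a j i := by
  rw [christoffelFirst, christoffelFirst, hG.pderiv_symm hy a i j]
  ring

theorem christoffel_symm {y : E4} (hy : y ∈ U) (m i j : Fin 4) :
    christoffel G y m i j = christoffel G y m j i := by
  simp only [christoffel_eq, hG.christoffelFirst_symm hy _ i j]

theorem pderiv_christoffel_symm {y : E4} (hy : y ∈ U) (t m i j : Fin 4) :
    pderiv t (fun z => christoffel G z m i j) y = pderiv t (fun z => christoffel G z m j i) y :=
  pderiv_congr hG.isOpen (fun _ hz => hG.christoffel_symm hz m i j) hy t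

theorem sum_mul_christoffel {y : E4} (hy : y ∈ U) (a i j : Fin 4) :
    ∑ m, G y a m * christoffel G y m i j = christoffelFirst G y a i j := by
  simp only [christoffel_eq, Finset.mul_sum]
  rw [Finset.sum_comm]
  simp only [← mul_assoc, ← Finset.sum_mul, hG.sum_mul_inv hy, ite_mul, one_mul, zero_mul,
    Finset.sum_ite_eq, Finset.mem_univ, if_true]

theorem pderiv_eq_christoffelFirst {y : E4} (hy : y ∈ U) (t a m : Fin 4) :
    pderiv t (fun z => G z a m) y = christoffelFirst G y a t m + christoffelFirst G y m t a := by
  rw [christoffelFirst, christoffelFirst, hG.pderiv_symm hy t m a, hG.pderiv_symm hy m t a,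
    hG.pderiv_symm hy a t m]
  ring

theorem sum_mul_pderiv_christoffel {y : E4} (hy : y ∈ U) (t a i j : Fin 4) :
    ∑ m, G y a m * pderiv t (fun z => christoffel G z m i j) y
      = pderiv t (fun z => christoffelFirst G z a i j) y
        - ∑ m, (christoffelFirst G y a t m + christoffelFirst G y m t a)
          * christoffel G y m i j := by
  rw [eq_sub_iff_add_eq, ← Finset.sum_add_distrib,
    ← pderiv_congr hG.isOpen (fun z hz => hG.sum_mul_christoffel hz a i j) hy t,
    pderiv_sum t fun m => (hG.differentiableAt hy a m).fun_mul
      (hG.differentiableAt_christoffel hy m i j)]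
  refine Finset.sum_congr rfl fun m _ => ?_
  rw [pderiv_mul t (hG.differentiableAt hy a m) (hG.differentiableAt_christoffel hy m i j),
    hG.pderiv_eq_christoffelFirst hy]
  ring

/-- Lowering the index past the derivative produces ∂g terms; half of them cancel the ΓΓ terms of
the curvature, and the other half remain with opposite sign. The result makes the antisymmetry in a,
i visible. -/
theorem riemann_eq {y : E4} (hy : y ∈ U) (a i j k : Fin 4) :
    riemann G y a i j k = pderiv j (fun z => christoffelFirst G z a k i) y
      - pderiv k (fun z => christoffelFirst G z a j i) y
      + ∑ m, (christoffelFirst G y m k a * christoffel G y m j i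
        - christoffelFirst G y m j a * christoffel G y m k i) := by
  have e : ∀ p q r : Fin 4, ∑ m, G y a m * ∑ n, christoffel G y m p n * christoffel G y n q r
      = ∑ n, christoffelFirst G y a p n * christoffel G y n q r := by
    intro p q r
    simp only [← hG.sum_mul_christoffel hy, Finset.mul_sum, Finset.sum_mul]
    rw [Finset.sum_comm]
    simp only [mul_assoc]
  simp only [riemann, curvature, mul_add, mul_sub, Finset.sum_add_distrib, Finset.sum_sub_distrib,
    hG.sum_mul_pderiv_christoffel hy, e, add_mul]
  ring

theorem sum_christoffelFirst_mul_christoffel {y : E4} (hy : y ∈ U) (p q r s : Fin 4) :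
    ∑ m, christoffelFirst G y m p q * christoffel G y m r s
      = ∑ m, christoffelFirst G y m r s * christoffel G y m p q := by
  simp only [christoffel_eq, Finset.mul_sum]
  rw [Finset.sum_comm]
  refine Finset.sum_congr rfl fun m _ => Finset.sum_congr rfl fun n _ => ?_
  rw [hG.inv_symm hy n m]
  ring

theorem pderiv_christoffelFirst {y : E4} (hy : y ∈ U) (t a i j : Fin 4) :
    pderiv t (fun z => christoffelFirst G z a i j) y
      = 1 / 2 * (pderiv t (pderiv i fun z => G z j a) y + pderiv t (pderiv j fun z => G z i a) y
        - pderiv t (pderiv a fun z => G z i j) y) := by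
  have hd : ∀ i j k, DifferentiableAt ℝ (pderiv i fun z => G z j k) y := fun i j k =>
    differentiableAt_of_contDiffOn hG.isOpen (contDiffOn_pderiv hG.isOpen (hG.smooth j k) i) hy
  simp only [christoffelFirst]
  rw [pderiv_const_mul t _ (((hd _ _ _).fun_add (hd _ _ _)).fun_sub (hd _ _ _)),
    pderiv_sub t ((hd _ _ _).fun_add (hd _ _ _)) (hd _ _ _), pderiv_add t (hd _ _ _) (hd _ _ _)]

/-- The second derivatives of g cancel because partial derivatives commute, and the quadratic terms
cancel because g⁻¹ is symmetric. -/
theorem riemann_antisymm_left {y : E4} (hy : y ∈ U) (a i j k : Fin 4) :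
    riemann G y a i j k = -riemann G y i a j k := by
  have hs : ∀ t s i j, pderiv t (pderiv s fun z => G z i j) y
      = pderiv t (pderiv s fun z => G z j i) y := fun t s i j =>
    pderiv_congr hG.isOpen (fun z hz => hG.pderiv_symm hz s i j) hy t
  have hc : ∀ t s i j, pderiv t (pderiv s fun z => G z i j) y
      = pderiv s (pderiv t fun z => G z i j) y := fun t s i j =>
    pderiv_comm hG.isOpen (hG.smooth i j) hy t s
  rw [hG.riemann_eq hy, hG.riemann_eq hy, Finset.sum_sub_distrib, Finset.sum_sub_distrib,
    hG.sum_christoffelFirst_mul_christoffel hy k a j i,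
    hG.sum_christoffelFirst_mul_christoffel hy j a k i]
  simp only [hG.pderiv_christoffelFirst hy]
  rw [hc j k i a, hc j k a i, hs k j i a, hs j i k a, hs k i j a, hs j a k i, hs k a j i]
  ring

theorem riemann_bianchi {y : E4} (hy : y ∈ U) (a i j k : Fin 4) :
    riemann G y a i j k + riemann G y a j k i + riemann G y a k i j = 0 := by
  simp only [riemann, ← Finset.sum_add_distrib, ← mul_add]
  refine Finset.sum_eq_zero fun m _ => mul_eq_zero_of_right _ ?_
  simp only [curvature, Finset.sum_sub_distrib]
  simp only [hG.pderiv_christoffel_symm hy _ _ k i, hG.pderiv_christoffel_symm hy _ _ k j,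
    hG.pderiv_christoffel_symm hy _ _ j i, hG.christoffel_symm hy _ k i,
    hG.christoffel_symm hy _ k j, hG.christoffel_symm hy _ j i]
  ring

theorem riemann_pair_symm {y : E4} (hy : y ∈ U) (i j k l : Fin 4) :
    riemann G y i j k l = riemann G y k l i j := by
  have a := hG.riemann_antisymm_left hy
  have b := riemann_antisymm_right G y
  have c := hG.riemann_bianchi hy
  linarith [c i j k l, c j k l i, c k l i j, c l i j k, a i j k l, b i j k l, a j k l i,
    b j k l i, a k l i j, b k l i j, a l i j k, b l i j k, a i k l j, b i k l j, a i l j k,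
    b i l j k, a j l i k, b j l i k, a j i k l, b j i k l, a k i j l, b k i j l, a k j l i,
    b k j l i, a l j k i, b l j k i, a l k i j, b l k i j, a i k j l, a j l k i, b j k i l]

theorem ricci_symm {y : E4} (hy : y ∈ U) (i k : Fin 4) : ricci G y i k = ricci G y k i := by
  rw [ricci, ricci, Finset.sum_comm]
  refine Finset.sum_congr rfl fun l _ => Finset.sum_congr rfl fun j _ => ?_
  rw [hG.riemann_pair_symm hy i j k l, hG.inv_symm hy]

theorem isWeyl_weyl {y : E4} (hy : y ∈ U) : IsWeyl (G y)⁻¹ (weyl G y) where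
  antisymm_left i j k l := by
    rw [weyl, weyl, hG.riemann_antisymm_left hy]
    ring
  antisymm_right i j k l := by
    rw [weyl, weyl, riemann_antisymm_right]
    ring
  bianchi i j k l := by
    have h := hG.riemann_bianchi hy i j k l
    rw [weyl, weyl, weyl, hG.symm hy k j, hG.symm hy l j, hG.symm hy l k, hG.ricci_symm hy k j,
      hG.ricci_symm hy l j, hG.ricci_symm hy l k]
    linear_combination h
  trace j l := by
    have t1 : ∑ i, ∑ k, (G y)⁻¹ i k * riemann G y i j k l = ricci G y j l := by
      rw [ricci]
      refine Finset.sum_congr rfl fun i _ => Finset.sum_congr rfl fun k _ => ?_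
      rw [hG.riemann_antisymm_left hy, riemann_antisymm_right, neg_neg]
    have t2 : ∀ (f : Fin 4 → ℝ) (j : Fin 4),
        ∑ i, ∑ k, (G y)⁻¹ i k * (f i * G y j k) = f j := by
      intro f j
      simp only [mul_left_comm _ (f _), ← Finset.mul_sum, hG.symm hy j, hG.sum_inv_mul hy,
        mul_ite, mul_one, mul_zero, Finset.sum_ite_eq', Finset.mem_univ, if_true]
    have t3 : ∀ f : Fin 4 → ℝ, ∑ i, ∑ k, (G y)⁻¹ i k * (f k * G y i l) = f l := by
      intro f
      rw [Finset.sum_comm]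
      refine Eq.trans (Finset.sum_congr rfl fun k _ => Finset.sum_congr rfl fun i _ => ?_) (t2 f l)
      rw [hG.inv_symm hy i k, hG.symm hy i l]
    have t4 : ∑ i, ∑ k, (G y)⁻¹ i k * G y i k = 4 := by
      have : ∀ i, ∑ k, (G y)⁻¹ i k * G y i k = 1 := fun i => by
        simp only [hG.symm hy i, hG.sum_inv_mul hy, if_true]
      simp only [this]
      simp
    have t5 : ∑ i, ∑ k, (G y)⁻¹ i k * ricci G y i k = scalarCurvature G y := rfl
    have t6 := t2 (fun i => ricci G y i l) j
    have t7 := t3 fun k => ricci G y j k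
    have t8 := t2 (fun i => G y i l) j
    -- In dimension four the trace is Ric − ½(R g − Ric + 4 Ric − Ric) + (R/6)(4g − g) = 0.
    calc ∑ i, ∑ k, (G y)⁻¹ i k * weyl G y i j k l
        = ∑ i, ∑ k, (G y)⁻¹ i k * riemann G y i j k l
          - 1 / 2 * ((∑ i, ∑ k, (G y)⁻¹ i k * ricci G y i k) * G y j l
            - ∑ i, ∑ k, (G y)⁻¹ i k * (ricci G y i l * G y j k)
            + ricci G y j l * ∑ i, ∑ k, (G y)⁻¹ i k * G y i k
            - ∑ i, ∑ k, (G y)⁻¹ i k * (ricci G y j k * G y i l))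
          + scalarCurvature G y / 6 * ((∑ i, ∑ k, (G y)⁻¹ i k * G y i k) * G y j l
            - ∑ i, ∑ k, (G y)⁻¹ i k * (G y i l * G y j k)) := by
          simp only [Finset.mul_sum, Finset.sum_mul, ← Finset.sum_add_distrib,
            ← Finset.sum_sub_distrib]
          refine Finset.sum_congr rfl fun i _ => Finset.sum_congr rfl fun k _ => ?_
          rw [weyl]
          ring
      _ = 0 := by
          rw [t1, t4, t5, t6, t7, t8]
          ring

end IsMetricOn

/-! ### Metric compatibility of the covariant derivative. -/

/-- Exchanging an index of a multi-index with a summation index. -/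
theorem sum_sum_update {n : ℕ} (a : Fin n) (f : (Fin n → Fin 4) → Fin 4 → ℝ) :
    ∑ I, ∑ m, f I m = ∑ I, ∑ m, f (Function.update I a m) (I a) := by
  rw [← Fintype.sum_prod_type', ← Fintype.sum_prod_type']
  exact Fintype.sum_equiv ⟨fun p => (Function.update p.1 a p.2, p.1 a),
    fun p => (Function.update p.1 a p.2, p.1 a), fun p => by simp, fun p => by simp⟩ _ _
    fun p => by simp

theorem nabla_snoc {n : ℕ} (G : E4 → Matrix (Fin 4) (Fin 4) ℝ) (T : E4 → Tensor n) (y : E4)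
    (I : Fin n → Fin 4) (s : Fin 4) :
    nabla G T y (Fin.snoc I s) = pderiv s (fun z => T z I) y
      - ∑ a, ∑ m, christoffel G y m s (I a) * T y (Function.update I a m) := by
  rw [nabla]
  simp only [Fin.init_snoc, Fin.snoc_last]

theorem pderiv_prod {ι : Type*} [Fintype ι] [DecidableEq ι] {f : ι → E4 → ℝ} {y : E4} (t : Fin 4)
    (hf : ∀ i, DifferentiableAt ℝ (f i) y) :
    pderiv t (fun z => ∏ i, f i z) y
      = ∑ i, (∏ j ∈ Finset.univ.erase i, f j y) * pderiv t (f i) y := by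
  simp [pderiv, fderiv_finsetProd fun i _ => hf i]

namespace IsMetricOn

variable {G : E4 → Matrix (Fin 4) (Fin 4) ℝ} {U : Set E4} (hG : IsMetricOn G U)
include hG

theorem differentiableAt_inv {y : E4} (hy : y ∈ U) (i j : Fin 4) :
    DifferentiableAt ℝ (fun z => (G z)⁻¹ i j) y :=
  differentiableAt_of_contDiffOn hG.isOpen (hG.contDiffOn_inv i j) hy

/-- The inverse metric is parallel. -/
theorem pderiv_inv {y : E4} (hy : y ∈ U) (s i l : Fin 4) :
    pderiv s (fun z => (G z)⁻¹ i l) y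
      = -∑ m, (christoffel G y i s m * (G y)⁻¹ m l + christoffel G y l s m * (G y)⁻¹ i m) := by
  have h0 : ∀ k, ∑ j, pderiv s (fun z => (G z)⁻¹ i j) y * G y j k
      = -∑ j, (G y)⁻¹ i j * (christoffelFirst G y j s k + christoffelFirst G y k s j) := by
    intro k
    have h : pderiv s (fun z => ∑ j, (G z)⁻¹ i j * G z j k) y = 0 := by
      rw [pderiv_congr hG.isOpen (fun z hz => hG.sum_inv_mul hz i k) hy, pderiv_const]
    rw [pderiv_sum s fun j => (hG.differentiableAt_inv hy i j).fun_mul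
      (hG.differentiableAt hy j k)] at h
    rw [eq_neg_iff_add_eq_zero, ← Finset.sum_add_distrib, ← h]
    refine Finset.sum_congr rfl fun j _ => ?_
    rw [pderiv_mul s (hG.differentiableAt_inv hy i j) (hG.differentiableAt hy j k),
      hG.pderiv_eq_christoffelFirst hy]
    ring
  calc pderiv s (fun z => (G z)⁻¹ i l) y
      = ∑ j, pderiv s (fun z => (G z)⁻¹ i j) y * ∑ k, G y j k * (G y)⁻¹ k l := by
        simp only [hG.sum_mul_inv hy, mul_ite, mul_one, mul_zero, Finset.sum_ite_eq',
          Finset.mem_univ, if_true]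
    _ = ∑ k, (∑ j, pderiv s (fun z => (G z)⁻¹ i j) y * G y j k) * (G y)⁻¹ k l := by
        simp only [Finset.mul_sum, Finset.sum_mul]
        rw [Finset.sum_comm]
        simp only [mul_assoc]
    _ = -(∑ k, (∑ j, (G y)⁻¹ i j * christoffelFirst G y j s k) * (G y)⁻¹ k l
          + ∑ k, (∑ j, (G y)⁻¹ i j * christoffelFirst G y k s j) * (G y)⁻¹ k l) := by
        simp only [h0, mul_add, Finset.sum_add_distrib, neg_mul, add_mul, Finset.sum_neg_distrib]
    _ = _ := by
        congr 1
        rw [Finset.sum_add_distrib]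
        congr 1
        · simp only [christoffel_eq]
        · simp only [christoffel_eq, Finset.sum_mul]
          rw [Finset.sum_comm]
          refine Finset.sum_congr rfl fun j _ => Finset.sum_congr rfl fun k _ => ?_
          rw [hG.inv_symm hy k l]
          ring

/-- The differential of the squared norm of a tensor field. -/
theorem pderiv_normSq {n : ℕ} {T : E4 → Tensor n} {y : E4} (hy : y ∈ U)
    (hT : ∀ I, DifferentiableAt ℝ (fun z => T z I) y) (s : Fin 4) :
    pderiv s (fun z => normSq G z (T z)) y = 2 * ∑ I : Fin n → Fin 4, ∑ J : Fin n → Fin 4,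
      (∏ a, (G y)⁻¹ (I a) (J a)) * nabla G T y (Fin.snoc I s) * T y J := by
  have hg : ∀ I J : Fin n → Fin 4,
      DifferentiableAt ℝ (fun z => ∏ a, (G z)⁻¹ (I a) (J a)) y := fun I J =>
    (HasFDerivAt.finsetProd fun a _ =>
      (hG.differentiableAt_inv hy (I a) (J a)).hasFDerivAt).differentiableAt
  have hgT : ∀ I J : Fin n → Fin 4, DifferentiableAt ℝ
      (fun z => (∏ a, (G z)⁻¹ (I a) (J a)) * T z I * T z J) y := fun I J =>
    ((hg I J).fun_mul (hT I)).fun_mul (hT J)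
  set P : (Fin n → Fin 4) → (Fin n → Fin 4) → ℝ := fun I J => ∏ a, (G y)⁻¹ (I a) (J a)
  set Q : Fin n → (Fin n → Fin 4) → (Fin n → Fin 4) → ℝ :=
    fun a I J => ∏ b ∈ Finset.univ.erase a, (G y)⁻¹ (I b) (J b)
  have hPs : ∀ I J, P I J = P J I := fun I J =>
    Finset.prod_congr rfl fun a _ => hG.inv_symm hy _ _
  have hQs : ∀ a I J, Q a I J = Q a J I := fun a I J =>
    Finset.prod_congr rfl fun a _ => hG.inv_symm hy _ _
  have hQP : ∀ a I J, Q a I J * (G y)⁻¹ (I a) (J a) = P I J := fun a I J =>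
    Finset.prod_erase_mul _ _ (Finset.mem_univ a)
  have hQu : ∀ a I J m, Q a (Function.update I a m) J = Q a I J := fun a I J m =>
    Finset.prod_congr rfl fun b hb => by
      rw [Function.update_of_ne (Finset.ne_of_mem_erase hb)]
  -- The Christoffel contribution to ⟨∇_s T, T⟩. Differentiating the inverse metric yields it twice,
  -- once through I and once through J, which matches the factor 2.
  set C : ℝ := ∑ I, ∑ J, ∑ a, ∑ m,
    P I J * (christoffel G y m s (I a) * T y (Function.update I a m)) * T y J with hC
  have hA : ∑ I, ∑ J, ∑ a, ∑ m,
      Q a I J * (christoffel G y (I a) s m * (G y)⁻¹ m (J a)) * (T y I * T y J) = C := by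
    rw [hC, Finset.sum_comm]
    conv_rhs => rw [Finset.sum_comm]
    refine Finset.sum_congr rfl fun J _ => ?_
    rw [Finset.sum_comm]
    conv_rhs => rw [Finset.sum_comm]
    refine Finset.sum_congr rfl fun a _ => ?_
    rw [sum_sum_update a]
    refine Finset.sum_congr rfl fun I _ => Finset.sum_congr rfl fun m _ => ?_
    rw [hQu, Function.update_self, ← hQP a I J]
    ring
  have hB : ∑ I, ∑ J, ∑ a, ∑ m,
      Q a I J * (christoffel G y (J a) s m * (G y)⁻¹ (I a) m) * (T y I * T y J) = C := by
    rw [← hA, Finset.sum_comm]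
    refine Finset.sum_congr rfl fun I _ => Finset.sum_congr rfl fun J _ =>
      Finset.sum_congr rfl fun a _ => Finset.sum_congr rfl fun m _ => ?_
    rw [hQs, hG.inv_symm hy m]
    ring
  have hD : ∑ I, ∑ J, P I J * (T y I * pderiv s (fun z => T z J) y)
      = ∑ I, ∑ J, P I J * (pderiv s (fun z => T z I) y * T y J) := by
    rw [Finset.sum_comm]
    refine Finset.sum_congr rfl fun I _ => Finset.sum_congr rfl fun J _ => ?_
    rw [hPs]
    ring
  have hterm : ∀ I J, pderiv s (fun z => (∏ a, (G z)⁻¹ (I a) (J a)) * T z I * T z J) y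
      = P I J * (T y I * pderiv s (fun z => T z J) y)
        + P I J * (pderiv s (fun z => T z I) y * T y J)
        - (∑ a, ∑ m, Q a I J * (christoffel G y (I a) s m * (G y)⁻¹ m (J a)) * (T y I * T y J)
        + ∑ a, ∑ m, Q a I J * (christoffel G y (J a) s m * (G y)⁻¹ (I a) m)
          * (T y I * T y J)) := by
    intro I J
    rw [pderiv_mul s ((hg I J).fun_mul (hT I)) (hT J), pderiv_mul s (hg I J) (hT I),
      pderiv_prod s fun a => hG.differentiableAt_inv hy (I a) (J a)]
    simp only [hG.pderiv_inv hy]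
    have : ∀ a, ∏ j ∈ Finset.univ.erase a, (G y)⁻¹ (I j) (J j) = Q a I J := fun a => rfl
    have hPIJ : ∏ j, (G y)⁻¹ (I j) (J j) = P I J := rfl
    simp only [this, hPIJ, Finset.sum_add_distrib, ← Finset.sum_mul, mul_add, ← Finset.mul_sum,
      mul_neg, Finset.sum_neg_distrib]
    ring
  have hN : (fun z => normSq G z (T z))
      = fun z => ∑ I, ∑ J, (∏ a, (G z)⁻¹ (I a) (J a)) * T z I * T z J := rfl
  rw [hN, pderiv_sum s fun I => DifferentiableAt.fun_sum fun J _ => hgT I J]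
  simp only [pderiv_sum s (hgT _), hterm, Finset.sum_add_distrib, Finset.sum_sub_distrib, hA, hB,
    hD, nabla_snoc]
  have hR : ∑ I, ∑ J, P I J * (pderiv s (fun z => T z I) y
      - ∑ a, ∑ m, christoffel G y m s (I a) * T y (Function.update I a m)) * T y J
      = ∑ I, ∑ J, P I J * (pderiv s (fun z => T z I) y * T y J) - C := by
    rw [hC]
    simp only [← Finset.sum_sub_distrib, ← Finset.sum_mul, ← Finset.mul_sum]
    refine Finset.sum_congr rfl fun I _ => Finset.sum_congr rfl fun J _ => ?_
    ring
  rw [hR]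
  ring

/-- The covariant derivative of a field of tensors of Weyl type is of Weyl type. -/
theorem isWeyl_nabla {T : E4 → Tensor 4} {y : E4} (hy : y ∈ U)
    (hT : ∀ I, DifferentiableAt ℝ (fun z => T z I) y)
    (hW : ∀ z ∈ U, IsWeyl (G z)⁻¹ (curry4 (T z))) (s : Fin 4) :
    IsWeyl (G y)⁻¹ (curry4 fun I => nabla G T y (Fin.snoc I s)) := by
  have e : ∀ i j k l, curry4 (fun I => nabla G T y (Fin.snoc I s)) i j k l
      = pderiv s (fun z => curry4 (T z) i j k l) y
        - ∑ m, (christoffel G y m s i * curry4 (T y) m j k l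
          + christoffel G y m s j * curry4 (T y) i m k l
          + christoffel G y m s k * curry4 (T y) i j m l
          + christoffel G y m s l * curry4 (T y) i j k m) := by
    intro i j k l
    have u0 : ∀ m, Function.update ![i, j, k, l] 0 m = ![m, j, k, l] := fun m => by
      funext a; fin_cases a <;> rfl
    have u1 : ∀ m, Function.update ![i, j, k, l] 1 m = ![i, m, k, l] := fun m => by
      funext a; fin_cases a <;> rfl
    have u2 : ∀ m, Function.update ![i, j, k, l] 2 m = ![i, j, m, l] := fun m => by
      funext a; fin_cases a <;> rfl
    have u3 : ∀ m, Function.update ![i, j, k, l] 3 m = ![i, j, k, m] := fun m => by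
      funext a; fin_cases a <;> rfl
    rw [curry4, nabla_snoc, Fin.sum_univ_four]
    simp only [u0, u1, u2, u3, Finset.sum_add_distrib]
    rfl
  have hd : ∀ i j k l, DifferentiableAt ℝ (fun z => curry4 (T z) i j k l) y := fun i j k l =>
    hT _
  have W := hW y hy
  refine ⟨fun i j k l => ?_, fun i j k l => ?_, fun i j k l => ?_, fun j l => ?_⟩
  · rw [e, e, pderiv_congr hG.isOpen (fun z hz => (hW z hz).antisymm_left i j k l) hy, pderiv_neg,
      neg_sub, ← neg_add', neg_eq_iff_eq_neg, neg_sub, eq_sub_iff_add_eq, add_assoc,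
      ← Finset.sum_add_distrib, add_eq_left]
    refine Finset.sum_eq_zero fun m _ => ?_
    rw [W.antisymm_left m j, W.antisymm_left i m, W.antisymm_left i j m, W.antisymm_left i j k m]
    ring
  · rw [e, e, pderiv_congr hG.isOpen (fun z hz => (hW z hz).antisymm_right i j k l) hy, pderiv_neg,
      neg_sub, ← neg_add', neg_eq_iff_eq_neg, neg_sub, eq_sub_iff_add_eq, add_assoc,
      ← Finset.sum_add_distrib, add_eq_left]
    refine Finset.sum_eq_zero fun m _ => ?_
    rw [W.antisymm_right m j, W.antisymm_right i m, W.antisymm_right i j m,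
      W.antisymm_right i j k m]
    ring
  · have h0 : pderiv s (fun z => curry4 (T z) i j k l + curry4 (T z) i k l j
        + curry4 (T z) i l j k) y = 0 := by
      rw [pderiv_congr hG.isOpen (fun z hz => (hW z hz).bianchi i j k l) hy, pderiv_const]
    rw [pderiv_add s ((hd _ _ _ _).fun_add (hd _ _ _ _)) (hd _ _ _ _),
      pderiv_add s (hd _ _ _ _) (hd _ _ _ _)] at h0
    have h1 : ∀ (P Q : Fin 4 → ℝ) (R : Fin 4 → ℝ) (p q r : ℝ), p + q + r = 0 →
        (∀ m, P m + Q m + R m = 0) → p - ∑ m, P m + (q - ∑ m, Q m) + (r - ∑ m, R m) = 0 := by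
      intro P Q R p q r hp h
      have : ∑ m, P m + ∑ m, Q m + ∑ m, R m = 0 := by
        simp only [← Finset.sum_add_distrib, h, Finset.sum_const_zero]
      linarith
    rw [e, e, e]
    refine h1 _ _ _ _ _ _ h0 fun m => ?_
    linear_combination christoffel G y m s i * W.bianchi m j k l
      + christoffel G y m s j * W.bianchi i m k l + christoffel G y m s k * W.bianchi i j m l
      + christoffel G y m s l * W.bianchi i j k m
  · have h0 : ∑ i, ∑ k, ((G y)⁻¹ i k * pderiv s (fun z => curry4 (T z) i j k l) y
        + curry4 (T y) i j k l * pderiv s (fun z => (G z)⁻¹ i k) y) = 0 := by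
      have h : pderiv s (fun z => ∑ i, ∑ k, (G z)⁻¹ i k * curry4 (T z) i j k l) y = 0 := by
        rw [pderiv_congr hG.isOpen (fun z hz => (hW z hz).trace j l) hy, pderiv_const]
      have hm : ∀ i k, DifferentiableAt ℝ (fun z => (G z)⁻¹ i k * curry4 (T z) i j k l) y :=
        fun i k => (hG.differentiableAt_inv hy i k).fun_mul (hd i j k l)
      rw [pderiv_sum s fun i => DifferentiableAt.fun_sum fun k _ => hm i k] at h
      rw [← h]
      refine Finset.sum_congr rfl fun i _ => ?_
      rw [pderiv_sum s fun k => hm i k]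
      exact Finset.sum_congr rfl fun k _ =>
        (pderiv_mul s (hG.differentiableAt_inv hy i k) (hd i j k l)).symm
    -- On the traced slots i and k, the Christoffel terms are those in the derivative of g⁻¹ after
    -- renaming indices; on the free slots j and l (`h3`, `h4`) they are traces of T and vanish.
    have h1 : ∑ i, ∑ k, ∑ m, (G y)⁻¹ i k * (christoffel G y m s i * curry4 (T y) m j k l)
        = ∑ i, ∑ k, ∑ m, curry4 (T y) i j k l * (christoffel G y i s m * (G y)⁻¹ m k) := by
      rw [Finset.sum_comm_cycle]
      refine Finset.sum_congr rfl fun i _ => ?_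
      rw [Finset.sum_comm]
      exact Finset.sum_congr rfl fun k _ => Finset.sum_congr rfl fun m _ => by ring
    have h2 : ∑ i, ∑ k, ∑ m, (G y)⁻¹ i k * (christoffel G y m s k * curry4 (T y) i j m l)
        = ∑ i, ∑ k, ∑ m, curry4 (T y) i j k l * (christoffel G y k s m * (G y)⁻¹ i m) := by
      refine Finset.sum_congr rfl fun i _ => ?_
      rw [Finset.sum_comm]
      exact Finset.sum_congr rfl fun k _ => Finset.sum_congr rfl fun m _ => by ring
    have h3 : ∑ i, ∑ k, ∑ m, (G y)⁻¹ i k * (christoffel G y m s j * curry4 (T y) i m k l) = 0 := by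
      rw [Finset.sum_comm_cycle]
      simp only [mul_left_comm ((G y)⁻¹ _ _), ← Finset.mul_sum, W.trace, mul_zero,
        Finset.sum_const_zero]
    have h4 : ∑ i, ∑ k, ∑ m, (G y)⁻¹ i k * (christoffel G y m s l * curry4 (T y) i j k m) = 0 := by
      rw [Finset.sum_comm_cycle]
      simp only [mul_left_comm ((G y)⁻¹ _ _), ← Finset.mul_sum, W.trace, mul_zero,
        Finset.sum_const_zero]
    simp only [hG.pderiv_inv hy, mul_neg, Finset.mul_sum, mul_add, Finset.sum_add_distrib,
      Finset.sum_neg_distrib] at h0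
    simp only [e, mul_sub, mul_add, Finset.mul_sum, Finset.sum_add_distrib,
      Finset.sum_sub_distrib]
    linarith

end IsMetricOn

/-! ### The inequality in a coordinate domain. -/

namespace IsMetricOn

variable {G : E4 → Matrix (Fin 4) (Fin 4) ℝ} {U : Set E4} (hG : IsMetricOn G U)
include hG

/-- The columns of E form an orthonormal basis, obtained from a factorization of the positive matrix
G⁻¹. E is invertible because (det E)² = det G⁻¹ > 0. -/
theorem exists_frame {y : E4} (hy : y ∈ U) :
    ∃ E : Matrix (Fin 4) (Fin 4) ℝ, (G y)⁻¹ = E * E.transpose ∧ IsUnit E.det := by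
  obtain ⟨B, hB⟩ : ∃ B : Matrix (Fin 4) (Fin 4) ℝ, (G y)⁻¹ = B.conjTranspose * B := by
    open scoped MatrixOrder in
    exact CStarAlgebra.nonneg_iff_eq_star_mul_self.mp (hG.posDef y hy).inv.posSemidef.nonneg
  have hB' : (G y)⁻¹ = B.transpose * B.transpose.transpose := by
    rw [Matrix.transpose_transpose, hB, Matrix.conjTranspose_eq_transpose_of_trivial]
  refine ⟨B.transpose, hB', isUnit_iff_ne_zero.2 fun h => ?_⟩
  have h1 := (hG.posDef y hy).inv.det_pos
  rw [hB', Matrix.det_mul, h, zero_mul] at h1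
  exact lt_irrefl _ h1

/-- The refined Kato inequality for `W^±` in a coordinate domain. -/
theorem kato_halfWeyl (s : ℤˣ) {y : E4} (hy : y ∈ U) (hW : normHalfWeyl s G y ≠ 0) :
    (∀ k : ℝ, 0 ≤ k → k < 5 / 3 →
      gradHalfWeylSq s G y ≥ k * gradNormHalfWeylSq s G y
        - 8 * (k - 1) / (5 - 3 * k) * divHalfWeylSq s G y) ∧
    (divergence G (halfWeyl s G) y = 0 →
      gradHalfWeylSq s G y ≥ 5 / 3 * gradNormHalfWeylSq s G y) := by
  have hd : ∀ I, DifferentiableAt ℝ (fun z => halfWeyl s G z I) y := fun I =>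
    differentiableAt_of_contDiffOn hG.isOpen (hG.contDiffOn_halfWeyl s I) hy
  have hT : ∀ z ∈ U, IsWeyl (G z)⁻¹ (curry4 (halfWeyl s G z)) := by
    intro z hz
    obtain ⟨E, hE, hdet⟩ := hG.exists_frame hz
    exact isWeyl_halfWeyl hE hdet s (hG.isWeyl_weyl hz)
  obtain ⟨E, hE, -⟩ := hG.exists_frame hy
  have hn : normSq G y (halfWeyl s G y) ≠ 0 := fun h => hW (by rw [normHalfWeyl, h, Real.sqrt_zero])
  have hnd : DifferentiableAt ℝ (fun z => normSq G z (halfWeyl s G z)) y :=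
    DifferentiableAt.fun_sum fun I _ => DifferentiableAt.fun_sum fun J _ =>
      (((HasFDerivAt.finsetProd fun a _ =>
        (hG.differentiableAt_inv hy (I a) (J a)).hasFDerivAt).differentiableAt).fun_mul
          (hd I)).fun_mul (hd J)
  refine kato_of_isWeyl hE (hT y hy) (hG.isWeyl_nabla hy hd hT)
    (u := fun t => pderiv t (normHalfWeyl s G) y) (fun t => ?_) hW
  -- The chain rule for the square root is valid because |W^±| ≠ 0; its factor 1/2 cancels the 2 in
  -- the derivative of |W^±|².
  have h1 : pderiv t (normHalfWeyl s G) y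
      = 1 / (2 * √(normSq G y (halfWeyl s G y)))
        * pderiv t (fun z => normSq G z (halfWeyl s G z)) y := by
    have : normHalfWeyl s G = fun z => √(normSq G z (halfWeyl s G z)) := rfl
    rw [this, pderiv, fderiv_sqrt hnd hn]
    rfl
  rw [h1, hG.pderiv_normSq hy hd]
  have : √(normSq G y (halfWeyl s G y)) ≠ 0 := hW
  field_simp

end IsMetricOn

/-! ### From the manifold to a chart. -/

variable {M : Type*} [TopologicalSpace M] [ChartedSpace E4 M] [IsManifold (𝓡 4) ∞ M]

/-- The coordinate field is the tangent map of `φ.symm` composed with a constant section of Tℝ⁴. -/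
theorem contMDiffOn_coordVector {φ : OpenPartialHomeomorph M E4}
    (hφ : φ ∈ IsManifold.maximalAtlas (𝓡 4) ∞ M) (i : Fin 4) :
    ContMDiffOn 𝓘(ℝ, E4) (𝓡 4).tangent ∞
      (fun y => Bundle.TotalSpace.mk' E4 (E := fun x : M => TangentSpace (𝓡 4) x) (φ.symm y)
        (coordVector φ y i)) φ.target := by
  have hs := contMDiffOn_symm_of_mem_maximalAtlas hφ
  have ht := hs.contMDiffOn_tangentMapWithin (m := ∞) (by simp) φ.open_target.uniqueMDiffOn
  have hc : ContMDiffOn 𝓘(ℝ, E4) (𝓘(ℝ, E4)).tangent ∞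
      (fun y => (⟨y, EuclideanSpace.single i (1 : ℝ)⟩ : TangentBundle 𝓘(ℝ, E4) E4)) φ.target :=
    fun y _ => contMDiffWithinAt_vectorSpace_iff_contDiffWithinAt.2 contDiffWithinAt_const
  refine (ht.comp hc fun y hy => hy).congr fun y hy => ?_
  simp only [Function.comp, tangentMapWithin, coordVector,
    mfderivWithin_of_isOpen φ.open_target hy]

theorem isMetricOn_metricMatrix (g : Metric M) {φ : OpenPartialHomeomorph M E4}
    (hφ : φ ∈ IsManifold.maximalAtlas (𝓡 4) ∞ M) : IsMetricOn (metricMatrix g φ) φ.target where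
  isOpen := φ.open_target
  smooth i j := by
    rw [← contMDiffOn_iff_contDiffOn]
    intro y hy
    have hs := contMDiffOn_symm_of_mem_maximalAtlas hφ y hy
    have : ContMDiffWithinAt 𝓘(ℝ, E4) ((𝓡 4).prod 𝓘(ℝ)) ∞
        (fun y => Bundle.TotalSpace.mk' ℝ (E := Bundle.Trivial M ℝ) (φ.symm y)
          (g.inner (φ.symm y) (coordVector φ y i) (coordVector φ y j))) φ.target y := by
      apply ContMDiffWithinAt.clm_bundle_apply₂ (F₁ := E4) (F₂ := E4)
      · exact ContMDiffAt.comp_contMDiffWithinAt y g.contMDiff.contMDiffAt hs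
      · exact contMDiffOn_coordVector hφ i y hy
      · exact contMDiffOn_coordVector hφ j y hy
    simp only [Bundle.contMDiffWithinAt_totalSpace] at this
    exact this.2
  posDef y hy := by
    have hφd : φ.MDifferentiable (𝓡 4) 𝓘(ℝ, E4) :=
      ⟨(contMDiffOn_of_mem_maximalAtlas hφ).mdifferentiableOn (by simp),
        (contMDiffOn_symm_of_mem_maximalAtlas hφ).mdifferentiableOn (by simp)⟩
    refine Matrix.PosDef.of_dotProduct_mulVec_pos ?_ fun x hx => ?_
    · ext i j
      exact g.symm _ _ _
    -- The quadratic form of the matrix at x is g(Lx, Lx) with L the differential of `φ.symm`, which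
    -- is injective.
    · let L : E4 →L[ℝ] TangentSpace (𝓡 4) (φ.symm y) := mfderiv 𝓘(ℝ, E4) (𝓡 4) φ.symm y
      have hv : L (WithLp.toLp 2 x) = ∑ i, x i • coordVector φ y i := by
        have hx' : (WithLp.toLp 2 x : E4) = ∑ i, x i • EuclideanSpace.single i (1 : ℝ) := by
          ext j
          simp [Pi.single_apply]
        rw [hx', map_sum]
        exact Finset.sum_congr rfl fun i _ => L.map_smul _ _
      have hv0 : L (WithLp.toLp 2 x) ≠ 0 := by
        intro h
        have h1 : (WithLp.toLp 2 x : E4) = 0 :=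
          hφd.symm.mfderiv_injective hy (h.trans L.map_zero.symm)
        exact hx (by simpa using h1)
      have hpos := g.pos _ _ hv0
      rw [hv] at hpos
      refine hpos.trans_eq ?_
      simp only [map_sum, sum_apply, map_smul, smul_apply,
        smul_eq_mul, dotProduct, Matrix.mulVec, metricMatrix, Matrix.of_apply, star_trivial,
        Finset.mul_sum]
      rw [Finset.sum_comm]
      exact Finset.sum_congr rfl fun i _ => Finset.sum_congr rfl fun j _ => by ring

end KatoWeyl

end

theorem lemma5p1 {M : Type*} [TopologicalSpace M] [ChartedSpace KatoWeyl.E4 M]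
    [IsManifold (𝓡 4) ∞ M] (g : KatoWeyl.Metric M) (o : KatoWeyl.OrientedAtlas M)
    (s : ℤˣ) (p : M)
    (φ : OpenPartialHomeomorph M KatoWeyl.E4) (hφ : φ ∈ o.charts) (hp : p ∈ φ.source)
    (hW : KatoWeyl.normHalfWeyl s (KatoWeyl.metricMatrix g φ) (φ p) ≠ 0) :
    (∀ k : ℝ, 0 ≤ k → k < 5 / 3 →
      KatoWeyl.gradHalfWeylSq s (KatoWeyl.metricMatrix g φ) (φ p) ≥
        k * KatoWeyl.gradNormHalfWeylSq s (KatoWeyl.metricMatrix g φ) (φ p)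
          - 8 * (k - 1) / (5 - 3 * k)
            * KatoWeyl.divHalfWeylSq s (KatoWeyl.metricMatrix g φ) (φ p)) ∧
    (KatoWeyl.divergence (KatoWeyl.metricMatrix g φ)
        (KatoWeyl.halfWeyl s (KatoWeyl.metricMatrix g φ)) (φ p) = 0 →
      KatoWeyl.gradHalfWeylSq s (KatoWeyl.metricMatrix g φ) (φ p) ≥
        5 / 3 * KatoWeyl.gradNormHalfWeylSq s (KatoWeyl.metricMatrix g φ) (φ p)) :=
  (KatoWeyl.isMetricOn_metricMatrix g (o.smooth hφ)).kato_halfWeyl s (φ.map_source hp) hW
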